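/- Let $\ell^2$ be the real Hilbert space of square summable sequences $x=(x_j)_{j\ge 1}$, and for $i\ge 1$ let $$Y_i=\{x\in\ell^2:\ \|x\|\le i,\ x_j=0\text{ for all }j<i\}.$$ The *Hilbert flying saucer* is the set $X=\bigcup_{i\ge 1}Y_i\subset\ell^2$ with the induced length metric $d$: $d(x,y)$ is the infimum of the $\ell^2$-lengths of the paths in $X$ from $x$ to $y$. For a metric space $X$ with basepoint $o$ we use the following notions. - The *ideal boundary* $\partial_{\mathrm I}X$ is the set of geodesic rays $\gamma:[0,\infty)\to X$ parametrized by arclength (isometric embeddings), where $\gamma_1,\gamma_2$ are identified if $d(\gamma_1(t),\gamma_2(t))$ is bounded for $t\ge 0$. - With $\langle x,y\rangle_o=\frac12\big(d(x,o)+d(y,o)-d(x,y)\big)$, a *Gromov sequence* is a sequence $(x_n)$ in $X$ with $\langle x_m,x_n\rangle_o\to\infty$ as $m,n\to\infty$. For Gromov sequences write $(x,y)\in E$ if $\langle x_m,y_n\rangle_o\to\infty$ as $m,n\to\infty$. The *Gromov boundary* $\partial_{\mathrm G}X$ is the set of Gromov sequences modulo the transitive closure of $E$. - An *end* is a sequence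 $(U_n)$ with $U_{n+1}\subset U_n$, where $U_n$ is a connected component of $X\setminus\overline{B(o,n)}$. The *end boundary* $\partial_{\mathrm E}X$ is the set of ends. - The natural map $\nu:\partial_{\mathrm I}X\to\partial_{\mathrm G}X$ sends the class of a ray $\gamma$ to the class of $(\gamma(t_n))$, for any $t_n\to\infty$. If $X$ is CAT(0), the natural map $\epsilon:\partial_{\mathrm I}X\to\partial_{\mathrm E}X$ sends the class of $\gamma$ to the end $(U_n)$ such that, for each $n$, $\gamma(t)\in U_n$ for all sufficiently large $t$ (if $\gamma(0)=o$, then $U_n$ is the component that contains $\gamma(n+1)$). **Theorem.** The Hilbert flying saucer $X$ is a complete CAT(0) space. Its ideal boundary $\partial_{\mathrm I}X$ is empty, while, for every basepoint $o\in X$, its Gromov boundary $\partial_{\mathrm G}X$ and its end boundary $\partial_{\mathrm E}X$ are singleton sets. Thus the natural maps $\nu:\partial_{\mathrm I}X\to\partial_{\mathrm G}X$ and $\epsilon:\partial_{\mathrm I}X\to\partial_{\mathrm E}X$ are not surjective. -/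

import Mathlib

open Set Filter Topology
open scoped NNReal ENNReal

noncomputable section

/-! ### Geodesics and CAT(0) spaces -/

section Geodesic

variable {X : Type*} [MetricSpace X]

/-- `c` restricted to `[0, d(x,y)]` is a (unit speed) geodesic segment from `x` to `y`. -/
def IsGeodesicSegment (c : ℝ → X) (x y : X) : Prop :=
  c 0 = x ∧ c (dist x y) = y ∧
    ∀ s ∈ Icc 0 (dist x y), ∀ t ∈ Icc 0 (dist x y), dist (c s) (c t) = |s - t|

variable (X) in
/-- A geodesic space: any two points are joined by a geodesic segment. -/
def IsGeodesicSpace : Prop :=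
  ∀ x y : X, ∃ c : ℝ → X, IsGeodesicSegment c x y

variable (X) in
/-- A CAT(0) space: a geodesic space in which distances between points on the sides of geodesic
triangles do not exceed the distances between the comparison points in a comparison triangle in
the Euclidean plane. Any two sides share a vertex, which is called `p`, and both are
parametrized from `p`; two points on the same side have the same distance as their comparison
points anyway. -/
structure IsCAT0 : Prop where
  geodesic : IsGeodesicSpace X
  comparison : ∀ (p q r : X) (c₁ c₂ : ℝ → X),
    IsGeodesicSegment c₁ p q → IsGeodesicSegment c₂ p r →
    ∀ p' q' r' : EuclideanSpace ℝ (Fin 2),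
      dist p' q' = dist p q → dist p' r' = dist p r → dist q' r' = dist q r →
    ∀ s ∈ Icc 0 (dist p q), ∀ t ∈ Icc 0 (dist p r),
    ∀ x' ∈ segment ℝ p' q', ∀ y' ∈ segment ℝ p' r',
      dist p' x' = s → dist p' y' = t → dist (c₁ s) (c₂ t) ≤ dist x' y'

end Geodesic

/-! ### The ideal boundary -/

section Boundaries

variable (X : Type*) [MetricSpace X]

/-- A geodesic ray, parametrized by arclength. -/
structure GeodesicRay where
  toFun : ℝ≥0 → X
  isometry : Isometry toFun

/-- Two unit speed geodesic rays are equivalent if they stay at bounded distance. -/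
def idealSetoid : Setoid (GeodesicRay X) where
  r γ₁ γ₂ := ∃ K : ℝ, ∀ t : ℝ≥0, dist (γ₁.toFun t) (γ₂.toFun t) ≤ K
  iseqv :=
    { refl := fun _ => ⟨0, fun _ => by simp⟩
      symm := fun ⟨K, h⟩ => ⟨K, fun t => by rw [dist_comm]; exact h t⟩
      trans := fun ⟨K, h⟩ ⟨L, h'⟩ =>
        ⟨K + L, fun t => (dist_triangle _ _ _).trans (add_le_add (h t) (h' t))⟩ }

/-- The ideal boundary. -/
def IdealBoundary : Type _ := Quotient (idealSetoid X)

/-! ### The Gromov boundary -/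

variable {X}

/-- The Gromov product of `x` and `y` with respect to `w`. -/
def gromovProduct (x y w : X) : ℝ := (dist x w + dist y w - dist x y) / 2

/-- Gromov sequences (with basepoint `o`): the Gromov product of `x m` and `x n` tends to infinity
as `m, n → ∞`. -/
def IsGromovSeq (o : X) (x : ℕ → X) : Prop :=
  Tendsto (fun p : ℕ × ℕ => gromovProduct (x p.1) (x p.2) o) atTop atTop

variable (X) in
/-- The type of Gromov sequences. -/
def GromovSeq (o : X) : Type _ := {x : ℕ → X // IsGromovSeq o x}

/-- The relation `E` on Gromov sequences; in general it is not transitive. -/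
def gromovRel (o : X) (x y : GromovSeq X o) : Prop :=
  Tendsto (fun p : ℕ × ℕ => gromovProduct (x.1 p.1) (y.1 p.2) o) atTop atTop

theorem gromovRel_symm (o : X) (x y : GromovSeq X o) (h : gromovRel o x y) :
    gromovRel o y x := by
  have hs : Tendsto (Prod.swap : ℕ × ℕ → ℕ × ℕ) atTop atTop := by
    rw [← prod_atTop_atTop_eq]
    exact tendsto_snd.prodMk tendsto_fst
  refine (h.comp hs).congr fun p => ?_
  simp only [Function.comp, Prod.fst_swap, Prod.snd_swap, gromovProduct]
  rw [dist_comm (x.1 p.2) (y.1 p.1)]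
  ring

/-- The transitive closure of the relation `E`. -/
def gromovSetoid (o : X) : Setoid (GromovSeq X o) where
  r := Relation.TransGen (gromovRel o)
  iseqv :=
    { refl := fun x => Relation.TransGen.single x.2
      symm := fun h => by
        induction h with
        | single h => exact Relation.TransGen.single (gromovRel_symm o _ _ h)
        | tail _ h ih => exact Relation.TransGen.head (gromovRel_symm o _ _ h) ih
      trans := fun h h' => Relation.TransGen.trans h h' }

variable (X) in
/-- The Gromov boundary (with basepoint `o`). -/
def GromovBoundary (o : X) : Type _ := Quotient (gromovSetoid o)

/-! ### The end boundary -/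

variable (X) in
/-- The end boundary (with basepoint `o`): its elements, the ends, are the decreasing sequences
`U n` of connected components of `X \ closure (B(o,n))`. -/
@[ext]
structure EndBoundary (o : X) where
  U : ℕ → Set X
  isComponent : ∀ n : ℕ, ∃ x ∈ (closure (Metric.ball o (n : ℝ)))ᶜ,
    U n = connectedComponentIn (closure (Metric.ball o (n : ℝ)))ᶜ x
  nested : ∀ n : ℕ, U (n + 1) ⊆ U n

/-! ### The natural maps -/

theorem GeodesicRay.dist_eq (γ : GeodesicRay X) (s t : ℝ≥0) :
    dist (γ.toFun s) (γ.toFun t) = |(s : ℝ) - t| := by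
  rw [γ.isometry.dist_eq, NNReal.dist_eq]

theorem GeodesicRay.le_dist (γ : GeodesicRay X) (o : X) (t : ℝ≥0) :
    (t : ℝ) - dist (γ.toFun 0) o ≤ dist (γ.toFun t) o := by
  have h := γ.dist_eq t 0
  have h' := dist_triangle_right (γ.toFun t) (γ.toFun 0) o
  rw [h, NNReal.coe_zero, sub_zero, NNReal.abs_eq] at h'
  linarith

theorem gromovProduct_ray_ge (γ₁ γ₂ : GeodesicRay X) (o : X) {K : ℝ}
    (hK : ∀ t : ℝ≥0, dist (γ₁.toFun t) (γ₂.toFun t) ≤ K) (s t : ℝ≥0) :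
    min (s : ℝ) t - (dist (γ₁.toFun 0) o + dist (γ₂.toFun 0) o + K) / 2 ≤
      gromovProduct (γ₁.toFun s) (γ₂.toFun t) o := by
  have h₁ := γ₁.le_dist o s
  have h₂ := γ₂.le_dist o t
  have h₃ := dist_triangle (γ₁.toFun s) (γ₁.toFun t) (γ₂.toFun t)
  have h₄ := hK t
  rw [γ₁.dist_eq s t] at h₃
  have h₅ : min (s : ℝ) t = (s + t - |(s : ℝ) - t|) / 2 := by
    rcases le_total (s : ℝ) t with h | h
    · rw [min_eq_left h, abs_of_nonpos (by linarith)]; ring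
    · rw [min_eq_right h, abs_of_nonneg (by linarith)]; ring
  unfold gromovProduct
  linarith

theorem tendsto_gromovProduct_ray (γ₁ γ₂ : GeodesicRay X) (o : X)
    (h : ∃ K : ℝ, ∀ t : ℝ≥0, dist (γ₁.toFun t) (γ₂.toFun t) ≤ K) {a b : ℕ → ℝ≥0}
    (ha : Tendsto a atTop atTop) (hb : Tendsto b atTop atTop) :
    Tendsto (fun p : ℕ × ℕ => gromovProduct (γ₁.toFun (a p.1)) (γ₂.toFun (b p.2)) o)
      atTop atTop := by
  obtain ⟨K, hK⟩ := h
  refine tendsto_atTop_mono (fun p => gromovProduct_ray_ge γ₁ γ₂ o hK _ _) ?_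
  refine tendsto_atTop_add_const_right _ _ ?_
  rw [← prod_atTop_atTop_eq]
  refine tendsto_atTop.2 fun c => ?_
  have ha' := (NNReal.tendsto_coe_atTop.2 ha).comp (tendsto_fst (f := atTop) (g := (atTop : Filter ℕ)))
  have hb' := (NNReal.tendsto_coe_atTop.2 hb).comp (tendsto_snd (f := (atTop : Filter ℕ)) (g := atTop))
  filter_upwards [ha'.eventually_ge_atTop c, hb'.eventually_ge_atTop c] with p h₁ h₂
  exact le_min h₁ h₂

/-- The Gromov sequence of the points `γ (t n)` on a unit speed geodesic ray `γ`, where `t n` tends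
to infinity. -/
def raySeq (o : X) (γ : GeodesicRay X) (t : ℕ → ℝ≥0) (ht : Tendsto t atTop atTop) :
    GromovSeq X o :=
  ⟨fun n => γ.toFun (t n), tendsto_gromovProduct_ray γ γ o ⟨0, by simp⟩ ht ht⟩

/-- The natural map `ν` from the ideal boundary to the Gromov boundary: the class of a unit speed
geodesic ray `γ` is sent to the class of the Gromov sequence `(γ n)`. -/
def nuMap (o : X) : IdealBoundary X → GromovBoundary X o :=
  Quotient.lift
    (fun γ : GeodesicRay X =>
      (Quotient.mk (gromovSetoid o)
        (raySeq o γ (fun n => (n : ℝ≥0)) tendsto_natCast_atTop_atTop)))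
    (fun γ₁ γ₂ h => Quotient.sound (s := gromovSetoid o)
      (Relation.TransGen.single (tendsto_gromovProduct_ray γ₁ γ₂ o h
        tendsto_natCast_atTop_atTop tendsto_natCast_atTop_atTop)))

/-- In the definition of `ν`, any sequence `t n` tending to infinity can be used. -/
theorem nuMap_mk (o : X) (γ : GeodesicRay X) (t : ℕ → ℝ≥0) (ht : Tendsto t atTop atTop) :
    nuMap o (Quotient.mk (idealSetoid X) γ) = Quotient.mk (gromovSetoid o) (raySeq o γ t ht) :=
  Quotient.sound (s := gromovSetoid o)
    (Relation.TransGen.single (tendsto_gromovProduct_ray γ γ o ⟨0, by simp⟩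
      tendsto_natCast_atTop_atTop ht))

theorem mem_compl_closure_ball {o x : X} {n : ℝ} (h : n < dist x o) :
    x ∈ (closure (Metric.ball o n))ᶜ := fun hx =>
  absurd (Metric.mem_closedBall.1 (Metric.closure_ball_subset_closedBall hx)) (not_le.2 h)

/-- A tail of a geodesic ray is contained in a single component. -/
theorem GeodesicRay.mem_component (γ : GeodesicRay X) (o : X) {n : ℝ} {s t : ℝ≥0}
    (hs : n + dist (γ.toFun 0) o < s) (ht : n + dist (γ.toFun 0) o < t) :
    γ.toFun t ∈ connectedComponentIn (closure (Metric.ball o n))ᶜ (γ.toFun s) := by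
  have hc : IsPreconnected (γ.toFun '' (Ici (min s t))) :=
    isPreconnected_Ici.image _ γ.isometry.continuous.continuousOn
  refine hc.subset_connectedComponentIn (mem_image_of_mem _ (min_le_left s t)) ?_
    (mem_image_of_mem _ (min_le_right s t))
  rintro _ ⟨u, hu, rfl⟩
  have hu' : ((min s t : ℝ≥0) : ℝ) ≤ u := NNReal.coe_le_coe.2 hu
  have hm : n + dist (γ.toFun 0) o < ((min s t : ℝ≥0) : ℝ) := by
    rw [NNReal.coe_min]; exact lt_min hs ht
  refine mem_compl_closure_ball ?_
  have := γ.le_dist o u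
  linarith

/-- The parameter `n + 1 + d(γ(0), o)`, which is `n + 1` for a ray that starts at `o`. -/
def rayTime (o : X) (γ : GeodesicRay X) (n : ℕ) : ℝ≥0 := n + 1 + nndist (γ.toFun 0) o

theorem lt_rayTime (o : X) (γ : GeodesicRay X) (n : ℕ) :
    (n : ℝ) + dist (γ.toFun 0) o < rayTime o γ n := by
  simp only [rayTime, NNReal.coe_add, NNReal.coe_natCast, NNReal.coe_one, coe_nndist]
  linarith

/-- The end defined by a geodesic ray `γ`: `U n` is the component of `X \ closure (B(o,n))` that
contains `γ t` for all large `t`; in particular, it contains `γ (n + 1)` if `γ` starts at `o`. -/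
def rayEnd (o : X) (γ : GeodesicRay X) : EndBoundary X o where
  U n := connectedComponentIn (closure (Metric.ball o (n : ℝ)))ᶜ (γ.toFun (rayTime o γ n))
  isComponent n := ⟨_, mem_compl_closure_ball (by
    have h₁ := γ.le_dist o (rayTime o γ n)
    have h₂ := lt_rayTime o γ n
    linarith), rfl⟩
  nested n := by
    have h₁ := lt_rayTime o γ n
    have h₂ := lt_rayTime o γ (n + 1)
    push_cast at h₂
    have h₃ := γ.mem_component o (n := (n : ℝ)) h₁ (t := rayTime o γ (n + 1)) (by linarith)
    rw [connectedComponentIn_eq h₃]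
    refine connectedComponentIn_mono _ (compl_subset_compl.2 (closure_mono ?_))
    exact Metric.ball_subset_ball (by push_cast; linarith)

theorem rayEnd_of_source (o : X) (γ : GeodesicRay X) (h : γ.toFun 0 = o) (n : ℕ) :
    (rayEnd o γ).U n =
      connectedComponentIn (closure (Metric.ball o (n : ℝ)))ᶜ (γ.toFun (n + 1)) := by
  simp [rayEnd, rayTime, h]

theorem rayEnd_eq (hX : IsGeodesicSpace X) (o : X) (γ₁ γ₂ : GeodesicRay X)
    (h : ∃ K : ℝ, ∀ t : ℝ≥0, dist (γ₁.toFun t) (γ₂.toFun t) ≤ K) :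
    rayEnd o γ₁ = rayEnd o γ₂ := by
  obtain ⟨K, hK⟩ := h
  ext1
  funext n
  have hK0 : 0 ≤ K := dist_nonneg.trans (hK 0)
  set t : ℝ≥0 := rayTime o γ₁ n + rayTime o γ₂ n + K.toNNReal with ht
  have h₁ := lt_rayTime o γ₁ n
  have h₂ := lt_rayTime o γ₂ n
  have ht' : (t : ℝ) = rayTime o γ₁ n + rayTime o γ₂ n + K := by
    rw [ht, NNReal.coe_add, NNReal.coe_add, Real.coe_toNNReal K hK0]
  have g₁ : (0 : ℝ) ≤ rayTime o γ₁ n := NNReal.coe_nonneg _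
  have g₂ : (0 : ℝ) ≤ rayTime o γ₂ n := NNReal.coe_nonneg _
  have e₁ := connectedComponentIn_eq (γ₁.mem_component o h₁ (t := t) (by linarith))
  have e₂ := connectedComponentIn_eq (γ₂.mem_component o h₂ (t := t) (by linarith))
  change connectedComponentIn _ _ = connectedComponentIn _ _
  rw [e₁, e₂]
  obtain ⟨c, hc0, hc1, hc⟩ := hX (γ₁.toFun t) (γ₂.toFun t)
  have hd : (0 : ℝ) ≤ dist (γ₁.toFun t) (γ₂.toFun t) := dist_nonneg
  have hcont : ContinuousOn c (Icc 0 (dist (γ₁.toFun t) (γ₂.toFun t))) := by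
    refine LipschitzOnWith.continuousOn (K := 1) (LipschitzOnWith.of_dist_le_mul ?_)
    intro u hu v hv
    rw [hc u hu v hv, Real.dist_eq]
    simp
  have hpre := isPreconnected_Icc.image c hcont
  refine connectedComponentIn_eq (hpre.subset_connectedComponentIn
    ⟨0, left_mem_Icc.2 hd, hc0⟩ ?_ ⟨_, right_mem_Icc.2 hd, hc1⟩)
  rintro _ ⟨u, hu, rfl⟩
  refine mem_compl_closure_ball ?_
  have k₁ := hc 0 (left_mem_Icc.2 hd) u hu
  rw [hc0, zero_sub, abs_neg, abs_of_nonneg hu.1] at k₁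
  have k₂ := dist_triangle (γ₁.toFun t) (c u) o
  have k₃ := γ₁.le_dist o t
  have k₄ := hK t
  have k₅ := hu.2
  linarith

/-- The natural map `ε` from the ideal boundary to the end boundary of a geodesic space (in
particular, of a CAT(0) space). -/
def epsilonMap (hX : IsGeodesicSpace X) (o : X) : IdealBoundary X → EndBoundary X o :=
  Quotient.lift (rayEnd o) (rayEnd_eq hX o)

end Boundaries

/-! ### Induced length metrics -/

section Length

variable {S : Type*} [MetricSpace S]

/-- The length of a path. -/
def pathLength {x y : S} (γ : Path x y) : ℝ≥0∞ := eVariationOn γ univ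

/-- The length (extended) metric induced by the metric of `S`: the infimum of the lengths of the
paths in `S` from `x` to `y`. -/
def lengthEDist (x y : S) : ℝ≥0∞ := ⨅ γ : Path x y, pathLength γ

theorem edist_le_lengthEDist (x y : S) : edist x y ≤ lengthEDist x y := by
  refine le_iInf fun γ => ?_
  have := eVariationOn.edist_le γ (mem_univ 0) (mem_univ 1)
  simpa [pathLength] using this

theorem eq_of_lengthEDist_eq_zero {x y : S} (h : lengthEDist x y = 0) : x = y :=
  edist_le_zero.1 ((edist_le_lengthEDist x y).trans h.le)

theorem lengthEDist_self (x : S) : lengthEDist x x = 0 := by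
  refine le_antisymm ((iInf_le _ (Path.refl x)).trans ?_) bot_le
  refine (eVariationOn.constant_on ?_).le
  rintro _ ⟨a, _, rfl⟩ _ ⟨b, _, rfl⟩
  rfl

theorem lengthEDist_comm_le (x y : S) : lengthEDist x y ≤ lengthEDist y x := by
  refine le_iInf fun γ => (iInf_le _ γ.symm).trans ?_
  refine eVariationOn.comp_le_of_antitoneOn γ unitInterval.symm ?_ (mapsTo_univ _ _)
  intro a _ b _ hab
  exact unitInterval.symm_le_symm.2 hab

theorem pathLength_trans_le {x y z : S} (γ : Path x y) (γ' : Path y z) :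
    pathLength (γ.trans γ') ≤ pathLength γ + pathLength γ' := by
  set m : unitInterval := ⟨1 / 2, by norm_num, by norm_num⟩ with hm
  have hu : (univ : Set unitInterval) = Iic m ∪ Ici m := Iic_union_Ici.symm
  have hmono : Monotone (projIcc (0 : ℝ) 1 zero_le_one) := monotone_projIcc _
  unfold pathLength
  conv_lhs => rw [hu, eVariationOn.union _ isGreatest_Iic isLeast_Ici]
  refine add_le_add ?_ ?_
  · have h : EqOn (γ.trans γ')
        (γ ∘ fun t : unitInterval => projIcc (0 : ℝ) 1 zero_le_one (2 * (t : ℝ))) (Iic m) := by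
      intro t ht
      have ht' : (t : ℝ) ≤ 1 / 2 := ht
      have := Path.extend_trans_of_le_half γ γ' ht'
      rwa [Path.extend_extends'] at this
    rw [eVariationOn.congr h]
    refine eVariationOn.comp_le_of_monotoneOn γ _ ?_ (mapsTo_univ _ _)
    intro a _ b _ hab
    have hab' : (a : ℝ) ≤ b := hab
    exact hmono (by linarith)
  · have h : EqOn (γ.trans γ')
        (γ' ∘ fun t : unitInterval => projIcc (0 : ℝ) 1 zero_le_one (2 * (t : ℝ) - 1)) (Ici m) := by
      intro t ht
      have ht' : 1 / 2 ≤ (t : ℝ) := ht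
      have := Path.extend_trans_of_half_le γ γ' ht'
      rwa [Path.extend_extends'] at this
    rw [eVariationOn.congr h]
    refine eVariationOn.comp_le_of_monotoneOn γ' _ ?_ (mapsTo_univ _ _)
    intro a _ b _ hab
    have hab' : (a : ℝ) ≤ b := hab
    exact hmono (by linarith)

theorem lengthEDist_triangle (x y z : S) :
    lengthEDist x z ≤ lengthEDist x y + lengthEDist y z := by
  unfold lengthEDist
  refine ENNReal.le_iInf_add_iInf fun γ γ' => ?_
  exact (iInf_le _ (γ.trans γ')).trans (pathLength_trans_le γ γ')

end Length

/-! ### The Hilbert flying saucer -/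

/-- The real Hilbert space `ℓ²` of square summable sequences. -/
abbrev Ell2 : Type := lp (fun _ : ℕ => ℝ) 2

/-- The closed disk `Y_{i+1}` of radius `i + 1` and codimension `i` in `ℓ²`. Coordinates are
numbered from `0`, that is, `x k` is the `(k+1)`-st coordinate `x_{k+1}` of `x`. -/
def saucerDisk (i : ℕ) : Set Ell2 := {x | ‖x‖ ≤ (i : ℝ) + 1 ∧ ∀ k < i, x k = 0}

/-- The union of the disks, as a subset of `ℓ²`. -/
def saucerSet : Set Ell2 := ⋃ i : ℕ, saucerDisk i

theorem zero_mem_saucerSet : (0 : Ell2) ∈ saucerSet :=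
  mem_iUnion.2 ⟨0, by simp [saucerDisk]⟩

theorem smul_mem_saucerSet {x : Ell2} (hx : x ∈ saucerSet) {t : ℝ} (h0 : 0 ≤ t) (h1 : t ≤ 1) :
    t • x ∈ saucerSet := by
  obtain ⟨i, hi, hk⟩ := mem_iUnion.1 hx
  refine mem_iUnion.2 ⟨i, ?_, fun k hki => ?_⟩
  · rw [norm_smul, Real.norm_of_nonneg h0]
    exact (mul_le_of_le_one_left (norm_nonneg _) h1).trans hi
  · rw [lp.coeFn_smul, Pi.smul_apply, hk k hki, smul_zero]

/-- The straight path from the origin to a point. -/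
def saucerRadialPath (x : saucerSet) : Path (⟨0, zero_mem_saucerSet⟩ : saucerSet) x where
  toFun t := ⟨(t : ℝ) • (x : Ell2), smul_mem_saucerSet x.2 t.2.1 t.2.2⟩
  continuous_toFun := by fun_prop
  source' := by simp
  target' := by simp

theorem lengthEDist_origin_ne_top (x : saucerSet) :
    lengthEDist (⟨0, zero_mem_saucerSet⟩ : saucerSet) x ≠ ⊤ := by
  refine ne_top_of_le_ne_top ?_ (iInf_le _ (saucerRadialPath x))
  have hL : LipschitzOnWith ‖(x : Ell2)‖₊
      (fun t : ℝ => t • (x : Ell2)) univ := by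
    refine LipschitzOnWith.of_dist_le_mul fun a _ b _ => ?_
    rw [dist_eq_norm, ← sub_smul, norm_smul, Real.dist_eq, mul_comm]
    rfl
  have h1 : pathLength (saucerRadialPath x) =
      eVariationOn ((fun t : ℝ => t • (x : Ell2)) ∘ ((↑) : unitInterval → ℝ)) univ := rfl
  rw [h1]
  refine ne_top_of_le_ne_top ?_ (hL.comp_eVariationOn_le (mapsTo_univ _ _))
  refine ENNReal.mul_ne_top ENNReal.coe_ne_top ?_
  have hm : MonotoneOn ((↑) : unitInterval → ℝ) univ := fun a _ b _ hab => hab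
  have hI : (univ : Set unitInterval) = univ ∩ Icc 0 1 := by
    ext t
    exact ⟨fun _ => ⟨mem_univ _, t.2.1, t.2.2⟩, fun _ => mem_univ _⟩
  rw [hI, hm.eVariationOn_eq (mem_univ 0) (mem_univ 1)]
  exact ENNReal.ofReal_ne_top

/-- The Hilbert flying saucer. It carries the induced length metric (the instance below), and not
the restriction of the metric of `ℓ²`. -/
def HilbertFlyingSaucer : Type := saucerSet

/-- The induced length metric as an extended metric. -/
@[reducible] def saucerEMetric : EMetricSpace HilbertFlyingSaucer where
  edist x y := lengthEDist (S := saucerSet) x y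
  edist_self x := lengthEDist_self (S := saucerSet) x
  edist_comm x y := le_antisymm (lengthEDist_comm_le (S := saucerSet) x y)
    (lengthEDist_comm_le (S := saucerSet) y x)
  edist_triangle x y z := lengthEDist_triangle (S := saucerSet) x y z
  eq_of_edist_eq_zero {x y} h := by
    exact eq_of_lengthEDist_eq_zero (S := saucerSet) h

/-- The metric space structure of the Hilbert flying saucer: the induced length metric, which is
finite. -/
instance : MetricSpace HilbertFlyingSaucer :=
  @EMetricSpace.toMetricSpace HilbertFlyingSaucer saucerEMetric fun x y => by
    refine ne_top_of_le_ne_top (ENNReal.add_ne_top.2 ⟨?_, lengthEDist_origin_ne_top y⟩)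
      (lengthEDist_triangle (S := saucerSet) x ⟨0, zero_mem_saucerSet⟩ y)
    exact ne_top_of_le_ne_top (lengthEDist_origin_ne_top x) (lengthEDist_comm_le (S := saucerSet) _ _)

end

/-! The saucer is built by attaching disks one at a time. Disk `n` meets the union of the disks
before it in the neck `coordDisk n n` (empty lower part for `n = 0`), which is closed and convex,
and every path from the earlier disks to the later ones crosses it. The CAT(0) property of each
finite union thus follows by Reshetnyak gluing and induction (`lowerCAT0`). Any three points lie in
a finite union, hence `isCAT0`; bounded sets do too, hence completeness.

The gluing uses the angle form of the CAT(0) condition: two geodesics from a vertex enclose at most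
the comparison angle (`HingeLE`). Angles satisfy the triangle inequality (`AngleLE.trans`), and with
Alexandrov's lemma this lets two triangles be joined along a common side (`TriangleLE.glue`). The
neck is not compact, so shortest connections through it come from convexity instead: decreasing
closed bounded convex sets of a Hilbert space have a common point. In the end `isCAT0_of_hingeLE`
turns angles back into distances.

All three boundaries depend on one fact: a point of norm greater than `n` lies in a disk of index at
least `n`, so its first `n` coordinates vanish, and far points are almost orthogonal to any fixed
point (`exists_abs_inner_le`). A ray would give points at distance about `√(s² + t²)` instead of `t
- s`, so there is none. For a fixed `a` and a far `b`, a chord followed by a radial segment shows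
that the Gromov product at the origin is at least `‖a‖ / 5`; hence any two Gromov sequences have
`E`-related subsequences. Finally, two far points are joined through a far axis point `s • e_j` by
segments that avoid a large ball, so there is only one end. Maps from an empty set to singletons are
not surjective. -/

/-! ### Euclidean hinges -/

section Planar

/-- The length of the third side of a Euclidean triangle with sides `a`, `b` that enclose the
angle `θ`. -/
noncomputable def hingeLength (a b θ : ℝ) : ℝ := √(a ^ 2 + b ^ 2 - 2 * a * b * Real.cos θ)

theorem hingeLength_sq (a b θ : ℝ) :
    hingeLength a b θ ^ 2 = a ^ 2 + b ^ 2 - 2 * a * b * Real.cos θ := by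
  refine Real.sq_sqrt ?_
  nlinarith [sq_nonneg (a - b * Real.cos θ), sq_nonneg (b * Real.sin θ),
    Real.sin_sq_add_cos_sq θ]

theorem hingeLength_nonneg (a b θ : ℝ) : 0 ≤ hingeLength a b θ := Real.sqrt_nonneg _

theorem hingeLength_comm (a b θ : ℝ) : hingeLength a b θ = hingeLength b a θ := by
  unfold hingeLength; congr 1; ring

theorem hingeLength_pi {a b : ℝ} (ha : 0 ≤ a) (hb : 0 ≤ b) : hingeLength a b Real.pi = a + b := by
  rw [hingeLength, Real.cos_pi, show a ^ 2 + b ^ 2 - 2 * a * b * -1 = (a + b) ^ 2 by ring,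
    Real.sqrt_sq (add_nonneg ha hb)]

theorem hingeLength_mono {a b θ φ : ℝ} (ha : 0 ≤ a) (hb : 0 ≤ b) (hθ : 0 ≤ θ) (h : θ ≤ φ)
    (hφ : φ ≤ Real.pi) : hingeLength a b θ ≤ hingeLength a b φ := by
  refine Real.sqrt_le_sqrt ?_
  have := Real.cos_le_cos_of_nonneg_of_le_pi hθ hφ h
  have := mul_le_mul_of_nonneg_left this (by positivity : 0 ≤ 2 * a * b)
  linarith

theorem angle_le_of_hingeLength_le {a b θ φ : ℝ} (ha : 0 < a) (hb : 0 < b) (hθ : θ ≤ Real.pi)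
    (hφ : 0 ≤ φ) (h : hingeLength a b θ ≤ hingeLength a b φ) : θ ≤ φ := by
  by_contra! hlt
  have h1 := Real.cos_lt_cos_of_nonneg_of_le_pi hφ hθ hlt
  have h2 := mul_lt_mul_of_pos_left h1 (by positivity : 0 < 2 * a * b)
  have h3 := pow_le_pow_left₀ (hingeLength_nonneg a b θ) h 2
  rw [hingeLength_sq, hingeLength_sq] at h3
  linarith

/-- The point of the plane with the given polar coordinates. -/
noncomputable def polarPoint (a θ : ℝ) : ℂ := ⟨a * Real.cos θ, a * Real.sin θ⟩

theorem dist_polarPoint (a b θ φ : ℝ) :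
    dist (polarPoint a θ) (polarPoint b φ) = hingeLength a b (θ - φ) := by
  rw [Complex.dist_eq_re_im, hingeLength, Real.cos_sub]
  congr 1
  simp only [polarPoint]
  linear_combination a ^ 2 * Real.sin_sq_add_cos_sq θ + b ^ 2 * Real.sin_sq_add_cos_sq φ

/-- This is the planar triangle inequality for points in the directions `θ`, `0` and `-φ`. -/
theorem hingeLength_add_le (a m b θ φ : ℝ) :
    hingeLength a b (θ + φ) ≤ hingeLength a m θ + hingeLength m b φ := by
  have := dist_triangle (polarPoint a θ) (polarPoint m 0) (polarPoint b (-φ))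
  simpa [dist_polarPoint] using this

/-- Equality holds for the point where the segment between the two outer points crosses the middle
ray; `θ + φ ≤ π` ensures that it does. -/
theorem exists_hingeLength_add_eq {a b θ φ : ℝ} (ha : 0 ≤ a) (hb : 0 ≤ b) (hθ : 0 ≤ θ)
    (hφ : 0 ≤ φ) (h : θ + φ ≤ Real.pi) :
    ∃ m, 0 ≤ m ∧ hingeLength a m θ + hingeLength m b φ = hingeLength a b (θ + φ) := by
  have hs1 : 0 ≤ Real.sin θ := Real.sin_nonneg_of_nonneg_of_le_pi hθ (by linarith)
  have hs2 : 0 ≤ Real.sin φ := Real.sin_nonneg_of_nonneg_of_le_pi hφ (by linarith)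
  have hs3 : 0 ≤ Real.sin (θ + φ) := Real.sin_nonneg_of_nonneg_of_le_pi (by linarith) h
  -- In the degenerate case both outer points lie on the line of the middle ray, and `m` is one of
  -- `0`, `a`, `b`.
  rcases (add_nonneg (mul_nonneg ha hs1) (mul_nonneg hb hs2)).eq_or_lt' with h0 | hpos
  · have h1 : a * Real.sin θ = 0 := by nlinarith [mul_nonneg ha hs1, mul_nonneg hb hs2]
    have h2 : b * Real.sin φ = 0 := by nlinarith [mul_nonneg ha hs1, mul_nonneg hb hs2]
    rcases mul_eq_zero.1 h1 with rfl | h1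
    · exact ⟨0, le_rfl, by simp [hingeLength]⟩
    rcases mul_eq_zero.1 h2 with rfl | h2
    · exact ⟨0, le_rfl, by simp [hingeLength]⟩
    rcases hθ.eq_or_lt with rfl | hθ'
    · exact ⟨a, ha, by simp [hingeLength]; ring_nf; simp⟩
    have hθπ : θ = Real.pi := by
      by_contra hne
      exact (Real.sin_pos_of_pos_of_lt_pi hθ' (lt_of_le_of_ne (by linarith) hne)).ne' h1
    have hφ0 : φ = 0 := by linarith
    subst hφ0
    exact ⟨b, hb, by simp [hingeLength]; ring_nf; simp⟩
  · set D := a * Real.sin θ + b * Real.sin φ with hD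
    have hD0 : D ≠ 0 := hpos.ne'
    -- The value of `m` comes from areas: the two triangles cut off by the middle ray add up to the
    -- whole one.
    refine ⟨a * b * Real.sin (θ + φ) / D, by positivity, ?_⟩
    have hmem : polarPoint (a * b * Real.sin (θ + φ) / D) 0 ∈
        segment ℝ (polarPoint a θ) (polarPoint b (-φ)) := by
      refine ⟨b * Real.sin φ / D, a * Real.sin θ / D, by positivity, by positivity, ?_, ?_⟩
      · rw [← add_div, add_comm, div_self hD0]
      · apply Complex.ext
        · simp only [polarPoint, Complex.add_re, Complex.real_smul, Complex.mul_re,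
            Complex.ofReal_re, Complex.ofReal_im, Real.cos_neg, Real.cos_zero, Real.sin_add]
          field_simp
          ring
        · simp only [polarPoint, Complex.add_im, Complex.real_smul, Complex.mul_im,
            Complex.ofReal_re, Complex.ofReal_im, Real.sin_neg, Real.sin_zero]
          field_simp
          ring
    have := dist_add_dist_of_mem_segment hmem
    simpa [dist_polarPoint] using this

end Planar

/-! ### Geodesic segments -/

section Segments

variable {X : Type*} [MetricSpace X] {c : ℝ → X} {x y : X}

theorem IsGeodesicSegment.dist_left (h : IsGeodesicSegment c x y) {t : ℝ}
    (ht : t ∈ Icc 0 (dist x y)) : dist x (c t) = t := by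
  have := h.2.2 0 (left_mem_Icc.2 dist_nonneg) t ht
  rwa [h.1, zero_sub, abs_neg, abs_of_nonneg ht.1] at this

theorem IsGeodesicSegment.dist_right (h : IsGeodesicSegment c x y) {t : ℝ}
    (ht : t ∈ Icc 0 (dist x y)) : dist (c t) y = dist x y - t := by
  have := h.2.2 t ht _ (right_mem_Icc.2 dist_nonneg)
  rwa [h.2.1, abs_sub_comm, abs_of_nonneg (by linarith [ht.2])] at this

theorem IsGeodesicSegment.reverse (h : IsGeodesicSegment c x y) :
    IsGeodesicSegment (fun t => c (dist x y - t)) y x := by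
  refine ⟨by simpa using h.2.1, by simpa [dist_comm y x] using h.1, fun s hs t ht => ?_⟩
  rw [dist_comm y x] at hs ht
  rw [h.2.2 _ ⟨by linarith [hs.2], by linarith [hs.1]⟩ _ ⟨by linarith [ht.2], by linarith [ht.1]⟩,
    abs_sub_comm]
  congr 1
  ring

theorem IsGeodesicSegment.initial (h : IsGeodesicSegment c x y) {t : ℝ}
    (ht : t ∈ Icc 0 (dist x y)) : IsGeodesicSegment c x (c t) := by
  refine ⟨h.1, by rw [h.dist_left ht], fun u hu v hv => ?_⟩
  rw [h.dist_left ht] at hu hv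
  exact h.2.2 u ⟨hu.1, hu.2.trans ht.2⟩ v ⟨hv.1, hv.2.trans ht.2⟩

theorem IsGeodesicSegment.final (h : IsGeodesicSegment c x y) {t : ℝ}
    (ht : t ∈ Icc 0 (dist x y)) : IsGeodesicSegment (fun u => c (t + u)) (c t) y := by
  refine ⟨by simp, ?_, fun u hu v hv => ?_⟩
  · simp only [h.dist_right ht, add_sub_cancel, h.2.1]
  · rw [h.dist_right ht] at hu hv
    rw [h.2.2 _ ⟨by linarith [hu.1, ht.1], by linarith [hu.2]⟩ _
      ⟨by linarith [hv.1, ht.1], by linarith [hv.2]⟩]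
    congr 1
    ring

theorem IsGeodesicSegment.backward (h : IsGeodesicSegment c x y) {t : ℝ}
    (ht : t ∈ Icc 0 (dist x y)) : IsGeodesicSegment (fun u => c (t - u)) (c t) x := by
  have := (h.initial ht).reverse
  rwa [h.dist_left ht] at this

theorem IsGeodesicSegment.trans {z : X} {c' : ℝ → X} (h : IsGeodesicSegment c x z)
    (h' : IsGeodesicSegment c' z y) (hd : dist x z + dist z y = dist x y) :
    IsGeodesicSegment (fun t => if t ≤ dist x z then c t else c' (t - dist x z)) x y := by
  have hz : (0 : ℝ) ≤ dist x z := dist_nonneg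
  have hzy : (0 : ℝ) ≤ dist z y := dist_nonneg
  have key : ∀ s ∈ Icc 0 (dist x y), ∀ t ∈ Icc 0 (dist x y), s ≤ dist x z → dist x z < t →
      dist (c s) (c' (t - dist x z)) = |s - t| := by
    intro s hs t ht h1 h2
    have hs' : s ∈ Icc 0 (dist x z) := ⟨hs.1, h1⟩
    have ht' : t - dist x z ∈ Icc 0 (dist z y) := ⟨by linarith, by linarith [ht.2]⟩
    have e1 := h.dist_left hs'
    have e2 := h.dist_right hs'
    have e3 := h'.dist_left ht'
    have e4 := h'.dist_right ht'
    have t1 := dist_triangle (c s) z (c' (t - dist x z))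
    have t2 := dist_triangle4 x (c s) (c' (t - dist x z)) y
    rw [abs_of_nonpos (by linarith)]
    linarith
  refine ⟨by simp [h.1], ?_, fun s hs t ht => ?_⟩
  · by_cases h0 : dist x y ≤ dist x z
    · have : z = y := dist_le_zero.1 (by linarith)
      subst this
      simp [h.2.1]
    · simp only [h0, if_false]
      rw [← hd, add_sub_cancel_left, h'.2.1]
  · by_cases h1 : s ≤ dist x z <;> by_cases h2 : t ≤ dist x z <;> simp only [h1, h2, if_true, if_false]
    · exact h.2.2 s ⟨hs.1, h1⟩ t ⟨ht.1, h2⟩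
    · exact key s hs t ht h1 (not_le.1 h2)
    · rw [dist_comm, abs_sub_comm]
      exact key t ht s hs h2 (not_le.1 h1)
    · rw [h'.2.2 _ ⟨by linarith, by linarith [hs.2]⟩ _ ⟨by linarith, by linarith [ht.2]⟩]
      congr 1
      ring

end Segments

/-! ### Angles between geodesics -/

section Angles

variable {X : Type*} [MetricSpace X]

/-- The curves `c` and `c'` enclose at time `0` at most the angle `θ`. -/
def AngleLE (c c' : ℝ → X) (θ : ℝ) : Prop :=
  ∀ a b : ℝ, 0 ≤ a → 0 ≤ b → ∀ ε > 0, ∀ᶠ σ : ℝ in 𝓝[>] 0,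
    dist (c (a * σ)) (c' (b * σ)) ≤ σ * (hingeLength a b θ + ε)

theorem AngleLE.symm {c c' : ℝ → X} {θ : ℝ} (h : AngleLE c c' θ) : AngleLE c' c θ := by
  intro a b ha hb ε hε
  filter_upwards [h b a hb ha ε hε] with σ hσ
  rwa [dist_comm, hingeLength_comm]

theorem AngleLE.mono {c c' : ℝ → X} {θ φ : ℝ} (h : AngleLE c c' θ) (hθ : 0 ≤ θ) (hle : θ ≤ φ)
    (hφ : φ ≤ Real.pi) : AngleLE c c' φ := by
  intro a b ha hb ε hε
  filter_upwards [h a b ha hb ε hε, self_mem_nhdsWithin] with σ hσ hσ0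
  have hσ0 : 0 < σ := hσ0
  refine hσ.trans ?_
  have := hingeLength_mono ha hb hθ hle hφ
  gcongr

/-- For given speeds `a` and `b` of the outer curves, the middle curve is run at the speed `m` at
which the planar triangle inequality is an equality. This is why `AngleLE` allows arbitrary speeds.
-/
theorem AngleLE.trans {c c' c'' : ℝ → X} {θ φ : ℝ} (h : AngleLE c c' θ) (h' : AngleLE c' c'' φ)
    (hθ : 0 ≤ θ) (hφ : 0 ≤ φ) (hle : θ + φ ≤ Real.pi) : AngleLE c c'' (θ + φ) := by
  intro a b ha hb ε hε
  obtain ⟨m, hm, hmeq⟩ := exists_hingeLength_add_eq ha hb hθ hφ hle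
  filter_upwards [h a m ha hm (ε / 2) (by positivity), h' m b hm hb (ε / 2) (by positivity)]
    with σ h1 h2
  have := dist_triangle (c (a * σ)) (c' (m * σ)) (c'' (b * σ))
  rw [← hmeq]
  linarith

theorem eventually_mul_mem_Icc (a : ℝ) {d : ℝ} (ha : 0 ≤ a) (hd : 0 < d) :
    ∀ᶠ σ : ℝ in 𝓝[>] 0, a * σ ∈ Icc 0 d := by
  have h1 : Tendsto (fun σ : ℝ => a * σ) (𝓝[>] 0) (𝓝 0) := by
    have : Tendsto (fun σ : ℝ => a * σ) (𝓝 0) (𝓝 (a * 0)) := tendsto_id.const_mul a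
    rw [mul_zero] at this
    exact this.mono_left nhdsWithin_le_nhds
  filter_upwards [h1.eventually_lt_const hd, self_mem_nhdsWithin] with σ hσ hσ0
  exact ⟨mul_nonneg ha (le_of_lt hσ0), hσ.le⟩

theorem IsGeodesicSegment.angleLE_pi {c c' : ℝ → X} {x y y' : X} (h : IsGeodesicSegment c x y)
    (h' : IsGeodesicSegment c' x y') (hy : x ≠ y) (hy' : x ≠ y') : AngleLE c c' Real.pi := by
  intro a b ha hb ε hε
  filter_upwards [eventually_mul_mem_Icc a ha (dist_pos.2 hy),
    eventually_mul_mem_Icc b hb (dist_pos.2 hy'), self_mem_nhdsWithin] with σ h1 h2 h3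
  have h3 : 0 < σ := h3
  have := dist_triangle_left (c (a * σ)) (c' (b * σ)) x
  rw [h.dist_left h1, h'.dist_left h2] at this
  rw [hingeLength_pi ha hb]
  nlinarith

/-- The two directions of a geodesic at an inner point enclose the angle `π`. -/
theorem IsGeodesicSegment.pi_le_of_angleLE {c : ℝ → X} {x y : X} (h : IsGeodesicSegment c x y)
    {t : ℝ} (ht : t ∈ Ioo 0 (dist x y)) {θ : ℝ} (hθ0 : 0 ≤ θ)
    (hθ : AngleLE (fun u => c (t - u)) (fun u => c (t + u)) θ) : Real.pi ≤ θ := by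
  refine angle_le_of_hingeLength_le one_pos one_pos le_rfl hθ0 ?_
  refine le_of_forall_pos_le_add fun ε hε => ?_
  rw [hingeLength_pi zero_le_one zero_le_one]
  have hev := hθ 1 1 zero_le_one zero_le_one ε hε
  obtain ⟨σ, ⟨⟨h1, h2⟩, h3⟩, h4 : 0 < σ⟩ := (((hev.and (eventually_mul_mem_Icc 1 zero_le_one ht.1)).and
    (eventually_mul_mem_Icc 1 zero_le_one (sub_pos.2 ht.2))).and self_mem_nhdsWithin).exists
  simp only [one_mul] at h1 h2 h3
  rw [h.2.2 _ ⟨by linarith [h2.2], by linarith [ht.2]⟩ _ ⟨by linarith [ht.1], by linarith [h3.2]⟩,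
    abs_of_nonpos (by linarith)] at h1
  have : σ * (1 + 1) ≤ σ * (hingeLength 1 1 θ + ε) := by linarith
  exact le_of_mul_le_mul_left this h4

/-- The comparison angle at `x`. -/
noncomputable def compAngle (x y z : X) : ℝ :=
  Real.arccos ((dist x y ^ 2 + dist x z ^ 2 - dist y z ^ 2) / (2 * dist x y * dist x z))

theorem compAngle_nonneg (x y z : X) : 0 ≤ compAngle x y z := Real.arccos_nonneg _

theorem compAngle_le_pi (x y z : X) : compAngle x y z ≤ Real.pi := Real.arccos_le_pi _

theorem compAngle_comm (x y z : X) : compAngle x y z = compAngle x z y := by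
  unfold compAngle
  rw [dist_comm y z]
  congr 1
  ring

theorem cos_compAngle {x y z : X} (hy : x ≠ y) (hz : x ≠ z) : 2 * dist x y * dist x z *
    Real.cos (compAngle x y z) = dist x y ^ 2 + dist x z ^ 2 - dist y z ^ 2 := by
  have h1 := dist_pos.2 hy
  have h2 := dist_pos.2 hz
  have t1 := dist_triangle x y z
  have t2 := dist_triangle_left y z x
  have t3 := dist_triangle_right x y z
  have h3 : (0 : ℝ) ≤ dist y z := dist_nonneg
  rw [compAngle, Real.cos_arccos]
  · field_simp
  · rw [le_div_iff₀ (by positivity)]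
    nlinarith
  · rw [div_le_iff₀ (by positivity)]
    nlinarith

theorem hingeLength_compAngle {x y z : X} (hy : x ≠ y) (hz : x ≠ z) :
    hingeLength (dist x y) (dist x z) (compAngle x y z) = dist y z := by
  have := hingeLength_sq (dist x y) (dist x z) (compAngle x y z)
  rw [cos_compAngle hy hz] at this
  rw [← abs_of_nonneg (hingeLength_nonneg _ _ _), ← abs_of_nonneg (dist_nonneg (x := y) (y := z)),
    ← sq_eq_sq_iff_abs_eq_abs]
  linarith

/-- Any two geodesics from `x` to `y` and from `x` to `z` enclose at most the comparison angle. -/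
def HingeLE (x y z : X) : Prop :=
  x ≠ y → x ≠ z → ∀ c c' : ℝ → X, IsGeodesicSegment c x y → IsGeodesicSegment c' x z →
    AngleLE c c' (compAngle x y z)

theorem HingeLE.symm {x y z : X} (h : HingeLE x y z) : HingeLE x z y := by
  intro hz hy c c' hc hc'
  rw [compAngle_comm]
  exact (h hy hz c' c hc' hc).symm

/-- All three angles of a geodesic triangle are bounded by the comparison angles. -/
structure TriangleLE (x y z : X) : Prop where
  left : HingeLE x y z
  middle : HingeLE y x z
  right : HingeLE z x y

theorem TriangleLE.swap_left {x y z : X} (h : TriangleLE x y z) : TriangleLE y x z :=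
  ⟨h.middle, h.left, h.right.symm⟩

theorem TriangleLE.swap_right {x y z : X} (h : TriangleLE x y z) : TriangleLE x z y :=
  ⟨h.left.symm, h.right, h.middle⟩

/-- The distance from `p` to a point of a geodesic is at most the comparison distance if the two
hinges at this point satisfy the angle condition. -/
theorem IsGeodesicSegment.comparison_of_hingeLE {c d : ℝ → X} {p x y : X}
    (hc : IsGeodesicSegment c x y) {t : ℝ} (ht : t ∈ Icc 0 (dist x y))
    (hd : IsGeodesicSegment d (c t) p) (h1 : HingeLE (c t) x p) (h2 : HingeLE (c t) y p) :
    dist x y * dist p (c t) ^ 2 ≤ (dist x y - t) * dist p x ^ 2 + t * dist p y ^ 2 -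
      t * (dist x y - t) * dist x y := by
  rcases ht.1.eq_or_lt with rfl | ht0
  · rw [hc.1]; linarith
  rcases ht.2.eq_or_lt with rfl | ht1
  · rw [hc.2.1]; linarith
  have ex := hc.dist_left ht
  have ey := hc.dist_right ht
  by_cases hp : c t = p
  · subst hp
    rw [dist_self, dist_comm _ x, ex, ey]
    exact le_of_eq (by ring)
  have hx : c t ≠ x := fun h => by rw [h, dist_self] at ex; linarith
  have hy : c t ≠ y := fun h => by rw [h, dist_self] at ey; linarith
  have a1 := h1 hx hp _ _ (hc.backward ht) hd
  have a2 := (h2 hy hp _ _ (hc.final ht) hd).symm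
  have n1 := compAngle_nonneg (c t) x p
  have n2 := compAngle_nonneg (c t) y p
  -- Otherwise the two opposite directions of `c` would enclose less than `π`. Given this sum,
  -- adding the laws of cosines at `c t` yields Stewart's formula as an inequality.
  have hsum : Real.pi ≤ compAngle (c t) x p + compAngle (c t) y p := by
    by_contra! hlt
    exact absurd (hc.pi_le_of_angleLE ⟨ht0, ht1⟩ (by positivity) (a1.trans a2 n1 n2 hlt.le))
      (not_le.2 hlt)
  have hcos : Real.cos (compAngle (c t) x p) ≤ -Real.cos (compAngle (c t) y p) := by
    rw [← Real.cos_pi_sub]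
    exact Real.cos_le_cos_of_nonneg_of_le_pi (by linarith [compAngle_le_pi (c t) y p])
      (compAngle_le_pi _ _ _) (by linarith)
  have c1 := cos_compAngle hx hp
  have c2 := cos_compAngle hy hp
  rw [dist_comm (c t) x, ex] at c1
  rw [ey] at c2
  rw [dist_comm p (c t), dist_comm p x, dist_comm p y]
  have hpos : 0 ≤ 2 * t * (dist x y - t) * dist (c t) p :=
    mul_nonneg (mul_nonneg (by linarith) (by linarith)) dist_nonneg
  nlinarith [mul_le_mul_of_nonneg_left hcos hpos]

end Angles

/-! ### Gluing triangles -/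

section Gluing

variable {X : Type*} [MetricSpace X]

/-- The geodesic to `y` begins as a geodesic to `s`, so the angle at `x` is at most the comparison
angle of the triangle `p x s`. That angle is at most the one of `p x y`, because the distance from
`p` to `s` is at most its comparison distance. -/
theorem TriangleLE.hingeLE_glue {p x y s : X} {c d : ℝ → X} (hd : IsGeodesicSegment d s p)
    (hc : IsGeodesicSegment c x y) {t : ℝ} (ht : t ∈ Ioo 0 (dist x y)) (hs : c t = s)
    (h1 : TriangleLE p x s) (h2 : TriangleLE p s y) (hx : x ≠ p) :
    ∀ c', IsGeodesicSegment c' x p → AngleLE c' c (compAngle x p y) := by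
  subst hs
  intro c' hc'
  have ht' := Ioo_subset_Icc_self ht
  have ex := hc.dist_left ht'
  have hcmp := hc.comparison_of_hingeLE ht' hd h1.right.symm h2.middle.symm
  have hxs : x ≠ c t := fun h => by rw [← h, dist_self] at ex; linarith [ht.1]
  have hxy : x ≠ y := dist_pos.1 (ht.1.trans ht.2)
  refine (h1.middle hx hxs c' c hc' (hc.initial ht')).mono (compAngle_nonneg _ _ _) ?_
    (compAngle_le_pi _ _ _)
  refine Real.arccos_le_arccos ?_
  have hxp := dist_pos.2 hx
  have ht0 := ht.1
  have hD : 0 < dist x y := ht.1.trans ht.2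
  rw [ex, div_le_div_iff₀ (by positivity) (by positivity)]
  rw [dist_comm p x] at hcmp
  nlinarith [mul_le_mul_of_nonneg_left hcmp (by positivity : 0 ≤ 2 * dist x p)]

/-- Two triangles that satisfy the angle condition can be glued along a common side. -/
theorem TriangleLE.glue {p x y : X} (hgeo : ∃ c, IsGeodesicSegment c x y)
    (h : ∀ c, IsGeodesicSegment c x y → ∃ t ∈ Ioo 0 (dist x y),
      (∃ d, IsGeodesicSegment d (c t) p) ∧ TriangleLE p x (c t) ∧ TriangleLE p (c t) y) :
    TriangleLE p x y := by
  refine ⟨?_, ?_, ?_⟩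
  · intro hx hy c₁ c₂ hc₁ hc₂
    obtain ⟨c, hc⟩ := hgeo
    obtain ⟨t, ht, ⟨d, hd⟩, h1, h2⟩ := h c hc
    have ht' := Ioo_subset_Icc_self ht
    have ex := hc.dist_left ht'
    have ey := hc.dist_right ht'
    -- If the geodesic from `x` to `y` passes through `p`, the comparison angle is `π`, which bounds
    -- every angle.
    by_cases hp : p = c t
    · have hpi : compAngle p x y = Real.pi := by
        refine le_antisymm (compAngle_le_pi _ _ _) ?_
        refine angle_le_of_hingeLength_le (dist_pos.2 hx) (dist_pos.2 hy) le_rfl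
          (compAngle_nonneg _ _ _) ?_
        rw [hingeLength_compAngle hx hy, hingeLength_pi dist_nonneg dist_nonneg, hp,
          dist_comm _ x, ex, ey]
        linarith
      rw [hpi]
      exact hc₁.angleLE_pi hc₂ hx hy
    · have hd' := hd.reverse
      set d' : ℝ → X := fun u => d (dist (c t) p - u)
      have a1 := h1.left hx hp c₁ d' hc₁ hd'
      have a2 := h2.left hp hy d' c₂ hd' hc₂
      have n1 := compAngle_nonneg p x (c t)
      have n2 := compAngle_nonneg p (c t) y
      have l1 := compAngle_le_pi p x (c t)
      -- The second angle is truncated so that the sum stays within `[0, π]`, where hinges are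
      -- monotone in the angle.
      set ψ := min (compAngle p (c t) y) (Real.pi - compAngle p x (c t)) with hψ
      have hψ0 : 0 ≤ ψ := le_min n2 (by linarith)
      have hψ1 : ψ ≤ compAngle p (c t) y := min_le_left _ _
      have hψ2 : ψ ≤ Real.pi - compAngle p x (c t) := min_le_right _ _
      -- Alexandrov's lemma: placed side by side in the plane, the two hinges have a third side no
      -- longer than the distance from `x` to `c t` to `y`, which is `dist x y`.
      have hsum : compAngle p x (c t) + ψ ≤ compAngle p x y := by
        refine angle_le_of_hingeLength_le (dist_pos.2 hx) (dist_pos.2 hy) (by linarith)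
          (compAngle_nonneg _ _ _) ?_
        rw [hingeLength_compAngle hx hy]
        refine (hingeLength_add_le _ (dist p (c t)) _ _ _).trans ?_
        rw [hingeLength_compAngle hx hp]
        have := hingeLength_mono (dist_nonneg (x := p) (y := c t)) (dist_nonneg (x := p) (y := y))
          hψ0 hψ1 (compAngle_le_pi _ _ _)
        rw [hingeLength_compAngle hp hy] at this
        linarith
      -- If the truncation is active, the comparison angle at `p` is at least `π` and the trivial
      -- bound suffices.
      rcases le_total (compAngle p (c t) y) (Real.pi - compAngle p x (c t)) with hle | hle
      · rw [hψ, min_eq_left hle] at hsum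
        exact (a1.trans a2 n1 n2 (by linarith)).mono (by positivity) hsum (compAngle_le_pi _ _ _)
      · rw [hψ, min_eq_right hle] at hsum
        exact (hc₁.angleLE_pi hc₂ hx hy).mono Real.pi_pos.le (by linarith) (compAngle_le_pi _ _ _)
  · intro hx _ c' c hc' hc
    obtain ⟨t, ht, ⟨d, hd⟩, h1, h2⟩ := h c hc
    exact h1.hingeLE_glue hd hc ht rfl h2 hx c' hc'
  · intro hy _ c' c hc' hc
    obtain ⟨t, ht, ⟨d, hd⟩, h1, h2⟩ := h _ hc.reverse
    rw [dist_comm x y] at ht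
    exact h2.swap_right.hingeLE_glue hd hc ⟨by linarith [ht.2], by linarith [ht.1]⟩ rfl
      h1.swap_right hy c' hc'

end Gluing

/-! ### A criterion for the CAT(0) condition -/

section Criterion

/-- Stewart's theorem for a point of a segment of an inner product space. -/
theorem dist_mul_dist_sq_of_mem_segment {E : Type*} [NormedAddCommGroup E] [InnerProductSpace ℝ E]
    {p q x : E} (hx : x ∈ segment ℝ p q) (w : E) :
    dist p q * dist w x ^ 2 = (dist p q - dist p x) * dist w p ^ 2 + dist p x * dist w q ^ 2 -
      dist p x * (dist p q - dist p x) * dist p q := by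
  obtain ⟨a, b, ha, hb, hab, rfl⟩ := hx
  obtain rfl : a = 1 - b := by linarith
  have e1 : dist p ((1 - b) • p + b • q) = b * dist p q := by
    rw [dist_eq_norm, dist_eq_norm, show p - ((1 - b) • p + b • q) = b • (p - q) by module,
      norm_smul, Real.norm_of_nonneg hb]
  have e2 : dist w ((1 - b) • p + b • q) ^ 2 =
      (1 - b) * dist w p ^ 2 + b * dist w q ^ 2 - b * (1 - b) * dist p q ^ 2 := by
    have h1 : w - ((1 - b) • p + b • q) = (1 - b) • (w - p) + b • (w - q) := by module
    have h2 : p - q = (w - q) - (w - p) := by abel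
    rw [dist_eq_norm, dist_eq_norm, dist_eq_norm, dist_eq_norm, h1, h2]
    generalize w - p = u
    generalize w - q = v
    rw [norm_add_sq_real, norm_sub_sq_real, norm_smul, norm_smul, Real.norm_of_nonneg hb,
      Real.norm_of_nonneg ha, real_inner_smul_left, real_inner_smul_right, real_inner_comm]
    ring
  rw [e1, e2]
  ring

/-- The comparison for a vertex and a point of the opposite side is applied twice, from `r` to `c₁
s` and then from `c₁ s` to `c₂ t`. In the plane the same two relations are equalities. -/
theorem isCAT0_of_hingeLE {X : Type*} [MetricSpace X] (hX : IsGeodesicSpace X)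
    (h : ∀ x y z : X, HingeLE x y z) : IsCAT0 X := by
  refine ⟨hX, ?_⟩
  intro p q r c₁ c₂ hc₁ hc₂ p' q' r' hpq hpr hqr s hs t ht x' hx' y' hy' hsx hty
  rcases (dist_nonneg (x := p) (y := q)).eq_or_lt' with h0 | hQ
  · have hs0 : s = 0 := le_antisymm (h0 ▸ hs.2) hs.1
    rw [hs0] at hsx ⊢
    rw [← dist_le_zero.1 hsx.le, hty, hc₁.1, hc₂.dist_left ht]
  rcases (dist_nonneg (x := p) (y := r)).eq_or_lt' with h0 | hR
  · have ht0 : t = 0 := le_antisymm (h0 ▸ ht.2) ht.1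
    rw [ht0] at hty ⊢
    rw [← dist_le_zero.1 hty.le, dist_comm x', hsx, hc₂.1, dist_comm, hc₁.dist_left hs]
  obtain ⟨d₁, hd₁⟩ := hX (c₁ s) r
  obtain ⟨d₂, hd₂⟩ := hX (c₂ t) (c₁ s)
  have C1 := hc₁.comparison_of_hingeLE hs hd₁ (h _ _ _) (h _ _ _)
  have C2 := hc₂.comparison_of_hingeLE ht hd₂ (h _ _ _) (h _ _ _)
  have E1 := dist_mul_dist_sq_of_mem_segment hx' r'
  have E2 := dist_mul_dist_sq_of_mem_segment hy' x'
  rw [hsx, hpq, dist_comm r' p', hpr, dist_comm r' q', hqr] at E1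
  rw [hty, hpr, dist_comm x' p', hsx, dist_comm x' r'] at E2
  rw [dist_comm r p, dist_comm r q] at C1
  rw [dist_comm (c₁ s) p, hc₁.dist_left hs, dist_comm (c₁ s) r] at C2
  have F1 : dist r (c₁ s) ^ 2 ≤ dist r' x' ^ 2 :=
    le_of_mul_le_mul_left (C1.trans E1.ge) hQ
  have F2 : dist (c₁ s) (c₂ t) ^ 2 ≤ dist x' y' ^ 2 := by
    refine le_of_mul_le_mul_left (C2.trans (le_trans ?_ E2.ge)) hR
    have := mul_le_mul_of_nonneg_left F1 ht.1
    linarith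
  exact le_of_sq_le_sq F2 dist_nonneg

end Criterion

/-! ### Nested convex sets in a Hilbert space -/

section Nested

/-- The points of least norm in the sets have increasing bounded norms. The midpoint of two of them
lies in the larger set, so the parallelogram law makes them a Cauchy sequence. -/
theorem nonempty_iInter_of_isClosed_of_convex {E : Type*} [NormedAddCommGroup E]
    [InnerProductSpace ℝ E] [CompleteSpace E] {S : ℕ → Set E} (hanti : Antitone S)
    (hne : ∀ n, (S n).Nonempty) (hcl : ∀ n, IsClosed (S n)) (hconv : ∀ n, Convex ℝ (S n))
    (hbd : Bornology.IsBounded (S 0)) : (⋂ n, S n).Nonempty := by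
  have hmin : ∀ n, ∃ v ∈ S n, ∀ w ∈ S n, ‖v‖ ≤ ‖w‖ := by
    intro n
    obtain ⟨v, hv, hmin⟩ := exists_norm_eq_iInf_of_complete_convex (hne n) (hcl n).isComplete
      (hconv n) 0
    refine ⟨v, hv, fun w hw => ?_⟩
    simp only [zero_sub, norm_neg] at hmin
    rw [hmin]
    exact ciInf_le ⟨0, Set.forall_mem_range.2 fun _ => norm_nonneg _⟩ (⟨w, hw⟩ : S n)
  choose v hv hvmin using hmin
  have hmono : Monotone fun n => ‖v n‖ := fun m n hmn => hvmin m _ (hanti hmn (hv n))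
  obtain ⟨R, hR⟩ := hbd.exists_norm_le
  have hbdd : BddAbove (range fun n => ‖v n‖) :=
    ⟨R, by rintro _ ⟨n, rfl⟩; exact hR _ (hanti (Nat.zero_le n) (hv n))⟩
  have hlim := tendsto_atTop_ciSup hmono hbdd
  set l := ⨆ n, ‖v n‖
  have hle : ∀ n, ‖v n‖ ≤ l := fun n => le_ciSup hbdd n
  have hcau : CauchySeq v := by
    refine cauchySeq_of_le_tendsto_0' (fun n => √(2 * (l ^ 2 - ‖v n‖ ^ 2))) (fun m n hmn => ?_) ?_
    · refine Real.le_sqrt_of_sq_le ?_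
      have hmid := hvmin m _ (hconv m (hv m) (hanti hmn (hv n)) (by norm_num : (0 : ℝ) ≤ 1 / 2)
        (by norm_num : (0 : ℝ) ≤ 1 / 2) (by norm_num))
      rw [← smul_add, norm_smul, Real.norm_of_nonneg (by norm_num)] at hmid
      have hpar := parallelogram_law_with_norm ℝ (v m) (v n)
      have h1 := pow_le_pow_left₀ (norm_nonneg _) hmid 2
      have h2 := pow_le_pow_left₀ (norm_nonneg _) (hle n) 2
      rw [dist_eq_norm]
      nlinarith
    · have : Tendsto (fun n => √(2 * (l ^ 2 - ‖v n‖ ^ 2))) atTop (𝓝 √(2 * (l ^ 2 - l ^ 2))) :=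
        ((tendsto_const_nhds.sub (hlim.pow 2)).const_mul 2).sqrt
      simpa using this
  obtain ⟨w, hw⟩ := cauchySeq_tendsto_of_complete hcau
  refine ⟨w, mem_iInter.2 fun n => (hcl n).mem_of_tendsto hw ?_⟩
  filter_upwards [eventually_ge_atTop n] with m hm using hanti hm (hv m)

end Nested

/-! ### Splitting a path -/

section Splitting

theorem lengthEDist_add_le_pathLength {S : Type*} [MetricSpace S] {x y : S} (γ : Path x y)
    (t : unitInterval) : lengthEDist x (γ t) + lengthEDist (γ t) y ≤ pathLength γ := by
  have hsub : ∀ t₀ t₁ : unitInterval, t₀ ≤ t₁ →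
      pathLength (γ.subpath t₀ t₁) ≤ eVariationOn γ (Icc t₀ t₁) := by
    intro t₀ t₁ h
    refine eVariationOn.comp_le_of_monotoneOn (s := Icc t₀ t₁) γ
      (fun s => Set.Icc.convexComb t₀ t₁ s) ?_
      fun s _ => ⟨Set.Icc.le_convexComb h s, Set.Icc.convexComb_le h s⟩
    intro a _ b _ hab
    rw [← Subtype.coe_le_coe] at h hab ⊢
    simp only [Set.Icc.coe_convexComb]
    nlinarith
  have h0 : lengthEDist x (γ t) ≤ eVariationOn γ (Icc 0 t) :=
    (iInf_le _ ((γ.subpath 0 t).cast (by simp) rfl)).trans (hsub 0 t t.2.1)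
  have h1 : lengthEDist (γ t) y ≤ eVariationOn γ (Icc t 1) :=
    (iInf_le _ ((γ.subpath t 1).cast rfl (by simp))).trans (hsub t 1 t.2.2)
  have hadd := eVariationOn.Icc_add_Icc γ (s := univ) (a := 0) (b := t) (c := 1) t.2.1 t.2.2
    (mem_univ t)
  simp only [univ_inter] at hadd
  exact (add_le_add h0 h1).trans (hadd.le.trans (eVariationOn.mono _ (subset_univ _)))

end Splitting

/-! ### The disks of the flying saucer -/

section Disks

/-- The points of norm at most `r` whose first `n` coordinates vanish. -/
def coordDisk (r : ℝ) (n : ℕ) : Set Ell2 := {x | ‖x‖ ≤ r ∧ ∀ k < n, x k = 0}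

theorem coordDisk_subset {r s : ℝ} {m n : ℕ} (hr : r ≤ s) (hn : m ≤ n) :
    coordDisk r n ⊆ coordDisk s m :=
  fun _ hx => ⟨hx.1.trans hr, fun k hk => hx.2 k (hk.trans_le hn)⟩

theorem convex_coordDisk (r : ℝ) (n : ℕ) : Convex ℝ (coordDisk r n) := by
  intro x hx y hy a b ha hb hab
  refine ⟨?_, fun k hk => ?_⟩
  · have h1 : x ∈ Metric.closedBall (0 : Ell2) r := by simpa using hx.1
    have h2 : y ∈ Metric.closedBall (0 : Ell2) r := by simpa using hy.1
    simpa using convex_closedBall (0 : Ell2) r h1 h2 ha hb hab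
  · rw [lp.coeFn_add, Pi.add_apply, lp.coeFn_smul, lp.coeFn_smul, Pi.smul_apply, Pi.smul_apply,
      hx.2 k hk, hy.2 k hk, smul_zero, smul_zero, add_zero]

theorem isClosed_coordDisk (r : ℝ) (n : ℕ) : IsClosed (coordDisk r n) := by
  have h : coordDisk r n = {x : Ell2 | ‖x‖ ≤ r} ∩ ⋂ k, ⋂ _ : k < n, {x : Ell2 | x k = 0} := by
    ext x
    simp [coordDisk]
  rw [h]
  refine (isClosed_le continuous_norm continuous_const).inter ?_
  refine isClosed_iInter fun k => isClosed_iInter fun _ => ?_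
  exact isClosed_eq (lp.lipschitzWith_one_eval 2 k).continuous continuous_const

/-- The union of the first `n` disks. -/
def saucerLower (n : ℕ) : Set Ell2 := ⋃ i, ⋃ _ : i < n, saucerDisk i

/-- The union of the disks from the `n`-th on. -/
def saucerUpper (n : ℕ) : Set Ell2 := ⋃ i, ⋃ _ : n ≤ i, saucerDisk i

theorem mem_saucerLower {n : ℕ} {x : Ell2} : x ∈ saucerLower n ↔ ∃ i < n, x ∈ saucerDisk i := by
  simp [saucerLower]

theorem mem_saucerUpper {n : ℕ} {x : Ell2} : x ∈ saucerUpper n ↔ ∃ i, n ≤ i ∧ x ∈ saucerDisk i := by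
  simp [saucerUpper]

theorem saucerLower_mono {m n : ℕ} (h : m ≤ n) : saucerLower m ⊆ saucerLower n := by
  intro x hx
  obtain ⟨i, hi, hx⟩ := mem_saucerLower.1 hx
  exact mem_saucerLower.2 ⟨i, hi.trans_le h, hx⟩

theorem saucerLower_succ (n : ℕ) : saucerLower (n + 1) = saucerLower n ∪ saucerDisk n := by
  ext x
  simp only [mem_union, mem_saucerLower, Nat.lt_succ_iff_lt_or_eq, or_and_right, exists_or,
    exists_eq_left]

theorem saucerSet_subset (n : ℕ) : saucerSet ⊆ saucerLower n ∪ saucerUpper n := by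
  intro x hx
  obtain ⟨i, hi⟩ := mem_iUnion.1 hx
  rcases lt_or_ge i n with h | h
  · exact Or.inl (mem_saucerLower.2 ⟨i, h, hi⟩)
  · exact Or.inr (mem_saucerUpper.2 ⟨i, h, hi⟩)

theorem exists_mem_saucerLower {x : Ell2} (hx : x ∈ saucerSet) : ∃ n, x ∈ saucerLower n := by
  obtain ⟨i, hi⟩ := mem_iUnion.1 hx
  exact ⟨i + 1, mem_saucerLower.2 ⟨i, i.lt_succ_self, hi⟩⟩

theorem saucerDisk_subset_saucerSet (i : ℕ) : saucerDisk i ⊆ saucerSet := subset_iUnion _ i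

/-- Disks of index less than `n` have radius at most `n`, and in those of index at least `n` the
first `n` coordinates vanish. -/
theorem saucerLower_inter_saucerUpper (n : ℕ) :
    saucerLower n ∩ saucerUpper n ⊆ coordDisk n n := by
  rintro x ⟨h1, h2⟩
  obtain ⟨i, hi, hxi⟩ := mem_saucerLower.1 h1
  obtain ⟨j, hj, hxj⟩ := mem_saucerUpper.1 h2
  exact ⟨hxi.1.trans (by exact_mod_cast hi), fun k hk => hxj.2 k (hk.trans_le hj)⟩

theorem coordDisk_subset_saucerDisk (n : ℕ) : coordDisk n n ⊆ saucerDisk n :=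
  coordDisk_subset (by linarith) le_rfl

theorem coordDisk_subset_saucerDisk_pred (n : ℕ) : coordDisk (n + 1 : ℕ) (n + 1) ⊆ saucerDisk n :=
  coordDisk_subset (by push_cast; exact le_rfl) n.le_succ

/-- The point `x` only excludes `n = 0`, where `saucerLower 0` is empty but `coordDisk 0 0` contains
the origin. -/
theorem coordDisk_subset_saucerLower {n : ℕ} {x : Ell2} (hx : x ∈ saucerLower n) :
    coordDisk n n ⊆ saucerLower n := by
  obtain ⟨i, hi, -⟩ := mem_saucerLower.1 hx
  obtain ⟨m, rfl⟩ : ∃ m, n = m + 1 := ⟨n - 1, by omega⟩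
  exact fun z hz => mem_saucerLower.2 ⟨m, m.lt_succ_self, coordDisk_subset_saucerDisk_pred m hz⟩

/-- A point of the saucer of norm at most `n + 1` lies in one of the first disks. -/
theorem mem_saucerLower_of_norm_le {n : ℕ} {x : Ell2} (hx : x ∈ saucerSet)
    (h : ‖x‖ ≤ (n : ℝ) + 1) : x ∈ saucerLower (n + 1) := by
  obtain ⟨i, hi⟩ := mem_iUnion.1 hx
  rcases lt_or_ge i (n + 1) with hlt | hge
  · exact mem_saucerLower.2 ⟨i, hlt, hi⟩
  · exact mem_saucerLower.2 ⟨n, n.lt_succ_self, h, fun k hk => hi.2 k (by omega)⟩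

theorem exists_mem_saucerDisk_of_lt_norm {n : ℕ} {x : Ell2} (hx : x ∈ saucerSet)
    (h : (n : ℝ) < ‖x‖) : ∃ i, n ≤ i ∧ x ∈ saucerDisk i := by
  obtain ⟨i, hi⟩ := mem_iUnion.1 hx
  have h1 : (n : ℝ) < i + 1 := h.trans_le hi.1
  exact ⟨i, by exact_mod_cast Nat.lt_succ_iff.1 (by exact_mod_cast h1), hi⟩

theorem isClosed_saucerLower (n : ℕ) : IsClosed (saucerLower n) :=
  (finite_Iio n).isClosed_biUnion fun _ _ => isClosed_coordDisk _ _

/-- Locally the union is finite: inside the ball of radius `M`, all disks of index at least `M` are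
contained in disk `M`. -/
theorem isClosed_saucerUpper (n : ℕ) : IsClosed (saucerUpper n) := by
  refine isClosed_of_closure_subset fun x hx => ?_
  obtain ⟨M, hM⟩ := exists_nat_gt (‖x‖ + n)
  have hx1 : ‖x‖ < M := by linarith [Nat.cast_nonneg (α := ℝ) n]
  have hnM : n ≤ M := by
    have : (n : ℝ) < M := by linarith [norm_nonneg x]
    exact_mod_cast this.le
  have hfin : IsClosed (⋃ i ∈ Icc n M, saucerDisk i) :=
    (finite_Icc n M).isClosed_biUnion fun _ _ => isClosed_coordDisk _ _
  have h1 : x ∈ closure (Metric.ball 0 (M : ℝ) ∩ saucerUpper n) :=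
    Metric.isOpen_ball.inter_closure ⟨by simpa using hx1, hx⟩
  have h2 : Metric.ball 0 (M : ℝ) ∩ saucerUpper n ⊆ ⋃ i ∈ Icc n M, saucerDisk i := by
    rintro y ⟨hy1, hy2⟩
    obtain ⟨i, hi, hyi⟩ := mem_saucerUpper.1 hy2
    rw [mem_ball_zero_iff] at hy1
    rcases le_total i M with h | h
    · exact mem_biUnion (show i ∈ Icc n M from ⟨hi, h⟩) hyi
    · exact mem_biUnion (show M ∈ Icc n M from ⟨hnM, le_rfl⟩)
        ⟨by linarith, fun k hk => hyi.2 k (hk.trans_le h)⟩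
  obtain ⟨i, hi, hxi⟩ := mem_iUnion₂.1 (hfin.closure_subset_iff.2 h2 h1)
  exact mem_saucerUpper.2 ⟨i, hi.1, hxi⟩

/-- A connected subset of the saucer that meets both parts meets the neck between them. -/
theorem exists_mem_neck {T : Type*} [TopologicalSpace T] {s : Set T} (hs : IsPreconnected s)
    {f : T → Ell2} (hf : ContinuousOn f s) (hfs : MapsTo f s saucerSet) {n : ℕ} {a b : T}
    (ha : a ∈ s) (hb : b ∈ s) (hfa : f a ∈ saucerLower n) (hfb : f b ∈ saucerUpper n) :
    ∃ t ∈ s, f t ∈ coordDisk n n := by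
  obtain ⟨_, ⟨t, ht, rfl⟩, h⟩ := isPreconnected_closed_iff.1 (hs.image f hf) _ _
    (isClosed_saucerLower n) (isClosed_saucerUpper n)
    (hfs.image_subset.trans (saucerSet_subset n)) ⟨_, mem_image_of_mem f ha, hfa⟩
    ⟨_, mem_image_of_mem f hb, hfb⟩
  exact ⟨t, ht, saucerLower_inter_saucerUpper n h⟩

/-- If the length distance of two points in both parts is less than `ℓ`, then there is a
point in the neck at total length distance less than `ℓ` to them. -/
theorem exists_mem_neck_lengthEDist_lt {n : ℕ} {x y : saucerSet} (hx : (x : Ell2) ∈ saucerLower n)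
    (hy : (y : Ell2) ∈ saucerUpper n) {ℓ : ℝ≥0∞} (h : lengthEDist x y < ℓ) :
    ∃ z : saucerSet, (z : Ell2) ∈ coordDisk n n ∧ lengthEDist x z + lengthEDist z y < ℓ := by
  obtain ⟨γ, hγ⟩ := iInf_lt_iff.1 h
  obtain ⟨t, -, ht⟩ := exists_mem_neck (s := univ) isPreconnected_univ
    (f := fun t : unitInterval => ((γ t : saucerSet) : Ell2))
    (continuous_subtype_val.comp γ.continuous).continuousOn (fun t _ => (γ t).2) (n := n)
    (mem_univ 0) (mem_univ 1) (by rw [γ.source]; exact hx) (by rw [γ.target]; exact hy)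
  exact ⟨γ t, ht, (lengthEDist_add_le_pathLength γ t).trans_lt hγ⟩

end Disks

/-! ### The metric of the flying saucer -/

namespace HilbertFlyingSaucer

/-- The underlying point of `ℓ²`. -/
def toEll2 (x : HilbertFlyingSaucer) : Ell2 := Subtype.val (p := (· ∈ saucerSet)) x

theorem toEll2_mem (x : HilbertFlyingSaucer) : x.toEll2 ∈ saucerSet :=
  Subtype.property (p := (· ∈ saucerSet)) x

/-- The point of the saucer with the given underlying point of `ℓ²`. -/
def mk (v : Ell2) (h : v ∈ saucerSet) : HilbertFlyingSaucer := (⟨v, h⟩ : saucerSet)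

theorem toEll2_injective : Function.Injective toEll2 := Subtype.val_injective

open Classical in
/-- The point of the saucer with the given underlying point of `ℓ²`, if there is one. -/
noncomputable def ofEll2 (v : Ell2) : HilbertFlyingSaucer :=
  if h : v ∈ saucerSet then mk v h else mk 0 zero_mem_saucerSet

theorem toEll2_ofEll2 {v : Ell2} (h : v ∈ saucerSet) : (ofEll2 v).toEll2 = v := by
  rw [ofEll2, dif_pos h]; rfl

theorem ofEll2_toEll2 (x : HilbertFlyingSaucer) : ofEll2 x.toEll2 = x :=
  toEll2_injective (toEll2_ofEll2 x.toEll2_mem)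

theorem lipschitzWith_toEll2 : LipschitzWith 1 toEll2 :=
  LipschitzWith.of_edist_le fun x y => edist_le_lengthEDist (S := saucerSet) x y

theorem dist_toEll2_le (x y : HilbertFlyingSaucer) : dist x.toEll2 y.toEll2 ≤ dist x y := by
  simpa using lipschitzWith_toEll2.dist_le_mul x y

theorem dist_eq_of_segment_subset {x y : HilbertFlyingSaucer}
    (h : segment ℝ x.toEll2 y.toEll2 ⊆ saucerSet) : dist x y = dist x.toEll2 y.toEll2 := by
  refine le_antisymm ?_ (dist_toEll2_le x y)
  let γ : Path (X := saucerSet) x y :=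
    { toFun := fun t => ⟨AffineMap.lineMap x.toEll2 y.toEll2 (t : ℝ), h (by
        rw [segment_eq_image_lineMap]
        exact ⟨t, t.2, rfl⟩)⟩
      continuous_toFun := by
        refine Continuous.subtype_mk ?_ _
        exact (AffineMap.lineMap_continuous (p := x.toEll2) (q := y.toEll2) (R := ℝ)).comp
          continuous_subtype_val
      source' := by
        apply Subtype.ext
        simp [toEll2]
      target' := by
        apply Subtype.ext
        simp [toEll2] }
  have h1 : edist x y ≤ pathLength γ := iInf_le _ γ
  have h2 : pathLength γ = eVariationOn ((fun t : ℝ => AffineMap.lineMap x.toEll2 y.toEll2 t) ∘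
      ((↑) : unitInterval → ℝ)) univ := rfl
  have hL : LipschitzOnWith (nndist x.toEll2 y.toEll2)
      (fun t : ℝ => AffineMap.lineMap x.toEll2 y.toEll2 t) univ :=
    (lipschitzWith_lineMap x.toEll2 y.toEll2).lipschitzOnWith
  have hm : MonotoneOn ((↑) : unitInterval → ℝ) univ := fun a _ b _ hab => hab
  have hI : (univ : Set unitInterval) = univ ∩ Icc 0 1 := by
    ext t
    exact ⟨fun _ => ⟨mem_univ _, t.2.1, t.2.2⟩, fun _ => mem_univ _⟩
  have h3 := hL.comp_eVariationOn_le (g := ((↑) : unitInterval → ℝ)) (mapsTo_univ _ univ)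
  rw [hI, hm.eVariationOn_eq (mem_univ 0) (mem_univ 1), ← hI] at h3
  simp only [Set.Icc.coe_one, Set.Icc.coe_zero, sub_zero, ENNReal.ofReal_one, mul_one] at h3
  rw [← h2, ← edist_nndist] at h3
  have h4 := h1.trans h3
  rwa [edist_dist, edist_dist, ENNReal.ofReal_le_ofReal_iff dist_nonneg] at h4

theorem dist_eq_of_mem_disk {i : ℕ} {x y : HilbertFlyingSaucer} (hx : x.toEll2 ∈ saucerDisk i)
    (hy : y.toEll2 ∈ saucerDisk i) : dist x y = dist x.toEll2 y.toEll2 :=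
  dist_eq_of_segment_subset (((convex_coordDisk _ _).segment_subset hx hy).trans
    (saucerDisk_subset_saucerSet i))

/-- The centre of the saucer. -/
noncomputable def origin : HilbertFlyingSaucer := mk 0 zero_mem_saucerSet

theorem toEll2_origin : origin.toEll2 = 0 := rfl

theorem dist_origin (x : HilbertFlyingSaucer) : dist x origin = ‖x.toEll2‖ := by
  obtain ⟨i, hi⟩ := mem_iUnion.1 x.toEll2_mem
  rw [dist_eq_of_mem_disk hi (y := origin) ⟨by simp [toEll2_origin]; positivity, fun k _ => by simp [toEll2_origin]⟩,
    toEll2_origin, dist_zero_right]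

theorem exists_mem_neck_dist_le {n : ℕ} {x y : HilbertFlyingSaucer}
    (hx : x.toEll2 ∈ saucerLower n) (hy : y.toEll2 ∈ saucerUpper n) {ε : ℝ} (hε : 0 < ε) :
    ∃ z : HilbertFlyingSaucer, z.toEll2 ∈ coordDisk n n ∧ dist x z + dist z y ≤ dist x y + ε := by
  have h1 : edist x y < edist x y + ENNReal.ofReal ε :=
    ENNReal.lt_add_right (edist_ne_top x y) (by simpa using hε)
  obtain ⟨z, hz, h⟩ : ∃ z : HilbertFlyingSaucer, z.toEll2 ∈ coordDisk n n ∧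
      edist x z + edist z y < edist x y + ENNReal.ofReal ε :=
    exists_mem_neck_lengthEDist_lt (x := x) (y := y) hx hy h1
  refine ⟨z, hz, ?_⟩
  have h2 := h.le
  rw [edist_dist, edist_dist, edist_dist, ← ENNReal.ofReal_add dist_nonneg dist_nonneg,
    ← ENNReal.ofReal_add dist_nonneg hε.le, ENNReal.ofReal_le_ofReal_iff (by positivity)] at h2
  exact h2

/-! ### Geodesics in a disk -/

section Flat

variable {i : ℕ} {x y z : HilbertFlyingSaucer}

theorem ofEll2_mem {s : Set Ell2} (hs : s ⊆ saucerSet) {v : Ell2} (hv : v ∈ s) :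
    (ofEll2 v).toEll2 ∈ s := by
  rwa [toEll2_ofEll2 (hs hv)]

theorem dist_ofEll2 {v w : Ell2} (hv : v ∈ saucerDisk i) (hw : w ∈ saucerDisk i) :
    dist (ofEll2 v) (ofEll2 w) = dist v w := by
  have hs := saucerDisk_subset_saucerSet i
  rw [dist_eq_of_mem_disk (ofEll2_mem hs hv) (ofEll2_mem hs hw), toEll2_ofEll2 (hs hv),
    toEll2_ofEll2 (hs hw)]

theorem continuousOn_ofEll2 (i : ℕ) : ContinuousOn ofEll2 (saucerDisk i) := by
  refine LipschitzOnWith.continuousOn (K := 1) (LipschitzOnWith.of_dist_le_mul ?_)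
  intro u hu v hv
  rw [dist_ofEll2 hu hv, NNReal.coe_one, one_mul]

theorem lineMap_mem_disk (hx : x.toEll2 ∈ saucerDisk i) (hy : y.toEll2 ∈ saucerDisk i) {r : ℝ}
    (hr : r ∈ Icc (0 : ℝ) 1) : AffineMap.lineMap x.toEll2 y.toEll2 r ∈ saucerDisk i := by
  refine (convex_coordDisk _ _).segment_subset hx hy ?_
  rw [segment_eq_image_lineMap]
  exact mem_image_of_mem _ hr

theorem div_dist_mem_Icc {t : ℝ} (ht : t ∈ Icc 0 (dist x y)) : t / dist x y ∈ Icc (0 : ℝ) 1 :=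
  ⟨div_nonneg ht.1 dist_nonneg, div_le_one_of_le₀ ht.2 dist_nonneg⟩

/-- The straight segment is a geodesic. -/
theorem isGeodesicSegment_lineMap (hx : x.toEll2 ∈ saucerDisk i) (hy : y.toEll2 ∈ saucerDisk i) :
    IsGeodesicSegment
      (fun t => ofEll2 (AffineMap.lineMap x.toEll2 y.toEll2 (t / dist x y))) x y := by
  refine ⟨by simp [ofEll2_toEll2], ?_, fun s hs t ht => ?_⟩
  · by_cases h : x = y
    · subst h
      simp [ofEll2_toEll2]
    · simp [div_self (dist_pos.2 h).ne', ofEll2_toEll2]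
  · rw [dist_ofEll2 (lineMap_mem_disk hx hy (div_dist_mem_Icc hs))
      (lineMap_mem_disk hx hy (div_dist_mem_Icc ht)), dist_lineMap_lineMap, Real.dist_eq,
      ← dist_eq_of_mem_disk hx hy, ← sub_div, abs_div, abs_of_nonneg dist_nonneg]
    by_cases h : dist x y = 0
    · rw [h] at hs ht ⊢
      rw [le_antisymm hs.2 hs.1, le_antisymm ht.2 ht.1]
      simp
    · field_simp

/-- Every geodesic between two points of a disk is straight. -/
theorem toEll2_geodesic (hx : x.toEll2 ∈ saucerDisk i) (hy : y.toEll2 ∈ saucerDisk i)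
    {c : ℝ → HilbertFlyingSaucer} (hc : IsGeodesicSegment c x y) {t : ℝ} (ht : t ∈ Icc 0 (dist x y)) :
    (c t).toEll2 = AffineMap.lineMap x.toEll2 y.toEll2 (t / dist x y) := by
  by_cases h : dist x y = 0
  · rw [h] at ht ⊢
    rw [le_antisymm ht.2 ht.1, hc.1]
    simp
  have h1 := dist_toEll2_le x (c t)
  have h2 := dist_toEll2_le (c t) y
  have h3 := dist_triangle x.toEll2 (c t).toEll2 y.toEll2
  rw [hc.dist_left ht] at h1
  rw [hc.dist_right ht] at h2
  rw [dist_eq_of_mem_disk hx hy] at h2 h ⊢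
  -- The `ℓ²` distances to the two ends are at most `t` and `dist x y - t`, and hence equal to them;
  -- strict convexity of the norm fixes the point.
  refine eq_lineMap_of_dist_eq_mul_of_dist_eq_mul ?_ ?_
  · rw [div_mul_cancel₀ _ h]; linarith
  · rw [sub_mul, div_mul_cancel₀ _ h]; linarith

/-- Geodesics in a disk are straight, so the law of cosines gives the bound with equality and
without `ε`. -/
theorem hingeLE_of_mem_disk (hx : x.toEll2 ∈ saucerDisk i) (hy : y.toEll2 ∈ saucerDisk i)
    (hz : z.toEll2 ∈ saucerDisk i) : HingeLE x y z := by
  intro hxy hxz c c' hc hc' a b ha hb ε hε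
  have hy0 := dist_pos.2 hxy
  have hz0 := dist_pos.2 hxz
  filter_upwards [eventually_mul_mem_Icc a ha hy0, eventually_mul_mem_Icc b hb hz0,
    self_mem_nhdsWithin] with σ h1 h2 h3
  have h3 : 0 < σ := h3
  have m1 := lineMap_mem_disk hx hy (div_dist_mem_Icc h1)
  have m2 := lineMap_mem_disk hx hz (div_dist_mem_Icc h2)
  rw [← toEll2_geodesic hx hy hc h1] at m1
  rw [← toEll2_geodesic hx hz hc' h2] at m2
  have key : dist (c (a * σ)) (c' (b * σ)) ^ 2 = (σ * hingeLength a b (compAngle x y z)) ^ 2 := by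
    have hcos := cos_compAngle hxy hxz
    rw [mul_pow, hingeLength_sq, dist_eq_of_mem_disk m1 m2, toEll2_geodesic hx hy hc h1,
      toEll2_geodesic hx hz hc' h2, AffineMap.lineMap_apply, AffineMap.lineMap_apply,
      dist_vadd_cancel_right, dist_eq_norm, norm_sub_sq_real, norm_smul, norm_smul,
      real_inner_smul_left, real_inner_smul_right,
      Real.norm_of_nonneg (div_dist_mem_Icc h1).1, Real.norm_of_nonneg (div_dist_mem_Icc h2).1,
      vsub_eq_sub, vsub_eq_sub]
    have e1 : ‖y.toEll2 - x.toEll2‖ = dist x y := by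
      rw [dist_eq_of_mem_disk hx hy, dist_comm, dist_eq_norm]
    have e2 : ‖z.toEll2 - x.toEll2‖ = dist x z := by
      rw [dist_eq_of_mem_disk hx hz, dist_comm, dist_eq_norm]
    have e3 : dist y z ^ 2 = ‖(y.toEll2 - x.toEll2) - (z.toEll2 - x.toEll2)‖ ^ 2 := by
      rw [dist_eq_of_mem_disk hy hz, dist_eq_norm, sub_sub_sub_cancel_right]
    rw [norm_sub_sq_real, e1, e2] at e3
    have e4 : inner ℝ (y.toEll2 - x.toEll2) (z.toEll2 - x.toEll2) =
        dist x y * dist x z * Real.cos (compAngle x y z) := by linarith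
    rw [e1, e2, e4]
    field_simp
    ring
  have := (pow_left_inj₀ dist_nonneg (mul_nonneg h3.le (hingeLength_nonneg _ _ _))
    two_ne_zero).1 key
  rw [this]
  gcongr
  linarith

theorem triangleLE_of_mem_disk (hx : x.toEll2 ∈ saucerDisk i) (hy : y.toEll2 ∈ saucerDisk i)
    (hz : z.toEll2 ∈ saucerDisk i) : TriangleLE x y z :=
  ⟨hingeLE_of_mem_disk hx hy hz, hingeLE_of_mem_disk hy hx hz, hingeLE_of_mem_disk hz hx hy⟩

end Flat

/-! ### Attaching a disk -/

section Attach

/-- Every geodesic crosses the neck, not only the ones constructed below; `TriangleLE.glue` asks for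
all of them, so uniqueness of geodesics is not needed. -/
theorem exists_mem_neck_of_isGeodesicSegment {n : ℕ} {c : ℝ → HilbertFlyingSaucer}
    {x y : HilbertFlyingSaucer} (hc : IsGeodesicSegment c x y) (hx : x.toEll2 ∈ saucerLower n)
    (hy : y.toEll2 ∈ saucerDisk n) : ∃ t ∈ Icc 0 (dist x y), (c t).toEll2 ∈ coordDisk n n := by
  have hcont : ContinuousOn c (Icc 0 (dist x y)) := by
    refine LipschitzOnWith.continuousOn (K := 1) (LipschitzOnWith.of_dist_le_mul ?_)
    intro u hu v hv
    rw [hc.2.2 u hu v hv, Real.dist_eq, NNReal.coe_one, one_mul]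
  refine exists_mem_neck isPreconnected_Icc (f := fun t => (c t).toEll2)
    (lipschitzWith_toEll2.continuous.comp_continuousOn hcont) (fun t _ => toEll2_mem _)
    (left_mem_Icc.2 dist_nonneg) (right_mem_Icc.2 dist_nonneg) ?_ ?_
  · simpa [hc.1] using hx
  · simpa [hc.2.1] using mem_saucerUpper.2 ⟨n, le_rfl, hy⟩

/-- The geometry of the union of the first `n` disks: points are joined by geodesics and the
angles of triangles are bounded by the comparison angles. -/
structure LowerCAT0 (n : ℕ) : Prop where
  geodesic : ∀ x y : HilbertFlyingSaucer, x.toEll2 ∈ saucerLower n → y.toEll2 ∈ saucerLower n →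
    ∃ c, IsGeodesicSegment c x y
  triangle : ∀ x y z : HilbertFlyingSaucer, x.toEll2 ∈ saucerLower n →
    y.toEll2 ∈ saucerLower n → z.toEll2 ∈ saucerLower n → TriangleLE x y z

variable {n : ℕ} {x y p : HilbertFlyingSaucer}

theorem neck_subset_saucerSet : coordDisk n n ⊆ saucerSet :=
  (coordDisk_subset_saucerDisk n).trans (saucerDisk_subset_saucerSet n)

/-- The distance from a point is a convex function on the neck. -/
theorem LowerCAT0.dist_le (h : LowerCAT0 n) (hx : x.toEll2 ∈ saucerLower n) {v w : Ell2}
    (hv : v ∈ coordDisk n n) (hw : w ∈ coordDisk n n) {a b : ℝ} (ha : 0 ≤ a) (hb : 0 ≤ b)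
    (hab : a + b = 1) :
    dist x (ofEll2 (a • v + b • w)) ≤ a * dist x (ofEll2 v) + b * dist x (ofEll2 w) := by
  obtain rfl : a = 1 - b := by linarith
  have hlow := coordDisk_subset_saucerLower hx
  have hV := ofEll2_mem neck_subset_saucerSet hv
  have hW := ofEll2_mem neck_subset_saucerSet hw
  have hV' := coordDisk_subset_saucerDisk n hV
  have hW' := coordDisk_subset_saucerDisk n hW
  have hu := convex_coordDisk n n hv hw ha hb hab
  have hU := hlow (ofEll2_mem neck_subset_saucerSet hu)
  by_cases hvw : v = w
  · subst hvw
    rw [← add_smul, sub_add_cancel, one_smul]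
    exact le_of_eq (by ring)
  have hc := isGeodesicSegment_lineMap hV' hW'
  have hne : ofEll2 v ≠ ofEll2 w := fun heq => hvw <| by
    have := congrArg toEll2 heq
    rwa [toEll2_ofEll2 (neck_subset_saucerSet hv), toEll2_ofEll2 (neck_subset_saucerSet hw)] at this
  have hD := dist_pos.2 hne
  set D := dist (ofEll2 v) (ofEll2 w) with hDdef
  have ht : b * D ∈ Icc 0 D := ⟨by positivity, by nlinarith⟩
  have hcu : ofEll2 (AffineMap.lineMap (ofEll2 v).toEll2 (ofEll2 w).toEll2 (b * D / D)) =
      ofEll2 ((1 - b) • v + b • w) := by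
    rw [mul_div_cancel_right₀ _ hD.ne', toEll2_ofEll2 (neck_subset_saucerSet hv),
      toEll2_ofEll2 (neck_subset_saucerSet hw), AffineMap.lineMap_apply_module]
  obtain ⟨d, hd⟩ := h.geodesic _ x hU hx
  have hcmp := hc.comparison_of_hingeLE (p := x) (t := b * D) (d := d) ht (by rwa [hcu])
    (by rw [hcu]; exact (h.triangle _ _ _ hU (hlow hV) hx).left)
    (by rw [hcu]; exact (h.triangle _ _ _ hU (hlow hW) hx).left)
  rw [hcu, ← hDdef] at hcmp
  have h1 : dist x (ofEll2 ((1 - b) • v + b • w)) ^ 2 ≤ (1 - b) * dist x (ofEll2 v) ^ 2 +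
      b * dist x (ofEll2 w) ^ 2 - b * (1 - b) * D ^ 2 := by
    refine le_of_mul_le_mul_left (hcmp.trans (le_of_eq ?_)) hD
    ring
  -- By this bound the Stewart correction `b * (1 - b) * D ^ 2` reduces the mean of the squares to
  -- at most the square of the mean.
  have h2 : (dist x (ofEll2 v) - dist x (ofEll2 w)) ^ 2 ≤ D ^ 2 := by
    refine sq_le_sq' ?_ ?_
    · linarith [dist_triangle x (ofEll2 v) (ofEll2 w)]
    · linarith [dist_triangle_right x (ofEll2 v) (ofEll2 w)]
  refine le_of_sq_le_sq ?_ (by positivity)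
  nlinarith [mul_le_mul_of_nonneg_left h2 (mul_nonneg hb ha)]

/-- Shortest connections through the neck exist. -/
theorem LowerCAT0.exists_mem_neck_dist_eq (h : LowerCAT0 n) (hx : x.toEll2 ∈ saucerLower n)
    (hy : y.toEll2 ∈ saucerDisk n) :
    ∃ z : HilbertFlyingSaucer, z.toEll2 ∈ coordDisk n n ∧ dist x z + dist z y = dist x y := by
  have hYup : y.toEll2 ∈ saucerUpper n := mem_saucerUpper.2 ⟨n, le_rfl, hy⟩
  set f : Ell2 → ℝ := fun v => dist x (ofEll2 v) + dist v y.toEll2 with hf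
  -- These are the neck points through which the connection has excess at most `1 / (k + 1)`; a
  -- common point has excess zero.
  set S : ℕ → Set Ell2 := fun k => {v ∈ coordDisk n n | f v ≤ dist x y + 1 / ((k : ℝ) + 1)} with hS
  have hfc : ContinuousOn f (coordDisk n n) := by
    have h1 := (continuousOn_ofEll2 n).mono (coordDisk_subset_saucerDisk n)
    exact fun v hv => (tendsto_const_nhds.dist (h1 v hv)).add
      ((continuous_id.dist continuous_const).continuousOn v hv)
  have hdy : ∀ v ∈ coordDisk n n, dist (ofEll2 v) y = dist v y.toEll2 := by
    intro v hv
    rw [dist_eq_of_mem_disk (coordDisk_subset_saucerDisk n (ofEll2_mem neck_subset_saucerSet hv)) hy,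
      toEll2_ofEll2 (neck_subset_saucerSet hv)]
  obtain ⟨v, hv⟩ : (⋂ k, S k).Nonempty := by
    refine nonempty_iInter_of_isClosed_of_convex ?_ ?_ ?_ ?_ ?_
    · intro k l hkl v hv
      refine ⟨hv.1, hv.2.trans ?_⟩
      gcongr
    · intro k
      obtain ⟨z, hz, hzd⟩ := exists_mem_neck_dist_le hx hYup
        (ε := 1 / ((k : ℝ) + 1)) (by positivity)
      refine ⟨z.toEll2, hz, ?_⟩
      simp only [hf]
      rwa [← hdy _ hz, ofEll2_toEll2]
    · intro k
      exact (isClosed_coordDisk n n).isClosed_le hfc continuousOn_const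
    · intro k v hv w hw a b ha hb hab
      refine ⟨convex_coordDisk n n hv.1 hw.1 ha hb hab, ?_⟩
      have h1 := h.dist_le hx hv.1 hw.1 ha hb hab
      have h2 : dist (a • v + b • w) y.toEll2 ≤ a * dist v y.toEll2 + b * dist w y.toEll2 :=
        (convexOn_univ_dist y.toEll2).2 (mem_univ v) (mem_univ w) ha hb hab
      have h3 := mul_le_mul_of_nonneg_left hv.2 ha
      have h4 := mul_le_mul_of_nonneg_left hw.2 hb
      simp only [hf] at h3 h4 ⊢
      have h5 : a * (dist x y + 1 / ((k : ℝ) + 1)) + b * (dist x y + 1 / ((k : ℝ) + 1)) =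
        dist x y + 1 / ((k : ℝ) + 1) := by rw [← add_mul, hab, one_mul]
      linarith
    · exact isBounded_iff_forall_norm_le.2 ⟨n, fun v hv => hv.1.1⟩
  have hv' := mem_iInter.1 hv
  have hvn := (hv' 0).1
  refine ⟨ofEll2 v, ofEll2_mem neck_subset_saucerSet hvn, le_antisymm ?_ (dist_triangle _ _ _)⟩
  rw [hdy v hvn]
  have hlim : Tendsto (fun k : ℕ => dist x y + 1 / ((k : ℝ) + 1)) atTop (𝓝 (dist x y + 0)) :=
    tendsto_one_div_add_atTop_nhds_zero_nat.const_add _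
  rw [add_zero] at hlim
  exact ge_of_tendsto' hlim fun k => (hv' k).2

theorem LowerCAT0.exists_isGeodesicSegment (h : LowerCAT0 n) (hx : x.toEll2 ∈ saucerLower n)
    (hy : y.toEll2 ∈ saucerDisk n) : ∃ c, IsGeodesicSegment c x y := by
  obtain ⟨z, hz, hzd⟩ := h.exists_mem_neck_dist_eq hx hy
  obtain ⟨c, hc⟩ := h.geodesic x z hx (coordDisk_subset_saucerLower hx hz)
  exact ⟨_, hc.trans (isGeodesicSegment_lineMap (coordDisk_subset_saucerDisk n hz) hy) hzd⟩

/-- Gluing at the point where a geodesic crosses the neck. -/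
theorem LowerCAT0.glue (h : LowerCAT0 n) (hx : x.toEll2 ∈ saucerLower n)
    (hx' : x.toEll2 ∉ saucerDisk n) (hy : y.toEll2 ∈ saucerDisk n)
    (hy' : y.toEll2 ∉ saucerLower n) (hp : p.toEll2 ∈ saucerLower n ∪ saucerDisk n)
    (hs : ∀ s : HilbertFlyingSaucer, s.toEll2 ∈ coordDisk n n → TriangleLE p x s ∧ TriangleLE p s y) :
    TriangleLE p x y := by
  refine TriangleLE.glue (h.exists_isGeodesicSegment hx hy) fun c hc => ?_
  obtain ⟨t, ht, hct⟩ := exists_mem_neck_of_isGeodesicSegment hc hx hy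
  have hlow := coordDisk_subset_saucerLower hx
  -- Neither endpoint is in the neck, so the crossing is at an inner parameter.
  refine ⟨t, ⟨lt_of_le_of_ne ht.1 ?_, lt_of_le_of_ne ht.2 ?_⟩, ?_, hs _ hct⟩
  · rintro rfl
    rw [hc.1] at hct
    exact hx' (coordDisk_subset_saucerDisk n hct)
  · rintro rfl
    rw [hc.2.1] at hct
    exact hy' (hlow hct)
  · rcases hp with hp | hp
    · exact h.geodesic _ _ (hlow hct) hp
    · exact h.exists_isGeodesicSegment (hlow hct) hp

/-- The triangle is cut at a neck point `s` of the side from `x` to `y`. For `p` in the neck both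
halves lie in one piece. For any other `p` one half lies in one piece and the other has the vertex
`s` in the neck, so this case must come before the next two. -/
theorem LowerCAT0.triangle_of_neck (h : LowerCAT0 n) (hp : p.toEll2 ∈ coordDisk n n)
    (hx : x.toEll2 ∈ saucerLower n) (hy : y.toEll2 ∈ saucerDisk n) : TriangleLE p x y := by
  have hlow := coordDisk_subset_saucerLower hx
  have hdisk := coordDisk_subset_saucerDisk n
  by_cases hx' : x.toEll2 ∈ saucerDisk n
  · exact triangleLE_of_mem_disk (hdisk hp) hx' hy
  by_cases hy' : y.toEll2 ∈ saucerLower n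
  · exact h.triangle _ _ _ (hlow hp) hx hy'
  exact h.glue hx hx' hy hy' (Or.inl (hlow hp)) fun s hs =>
    ⟨h.triangle _ _ _ (hlow hp) hx (hlow hs), triangleLE_of_mem_disk (hdisk hp) (hdisk hs) hy⟩

theorem mem_neck (hx : x.toEll2 ∈ saucerLower n) (hx' : x.toEll2 ∈ saucerDisk n) :
    x.toEll2 ∈ coordDisk n n :=
  saucerLower_inter_saucerUpper n ⟨hx, mem_saucerUpper.2 ⟨n, le_rfl, hx'⟩⟩

theorem LowerCAT0.triangle_of_lower (h : LowerCAT0 n) (hp : p.toEll2 ∈ saucerLower n)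
    (hx : x.toEll2 ∈ saucerLower n) (hy : y.toEll2 ∈ saucerDisk n) : TriangleLE p x y := by
  have hlow := coordDisk_subset_saucerLower hx
  by_cases hx' : x.toEll2 ∈ saucerDisk n
  · exact (h.triangle_of_neck (mem_neck hx hx') hp hy).swap_left
  by_cases hy' : y.toEll2 ∈ saucerLower n
  · exact h.triangle _ _ _ hp hx hy'
  exact h.glue hx hx' hy hy' (Or.inl hp) fun s hs =>
    ⟨h.triangle _ _ _ hp hx (hlow hs), (h.triangle_of_neck hs hp hy).swap_left⟩

theorem LowerCAT0.triangle_of_disk (h : LowerCAT0 n) (hp : p.toEll2 ∈ saucerDisk n)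
    (hx : x.toEll2 ∈ saucerLower n) (hy : y.toEll2 ∈ saucerDisk n) : TriangleLE p x y := by
  by_cases hx' : x.toEll2 ∈ saucerDisk n
  · exact triangleLE_of_mem_disk hp hx' hy
  by_cases hy' : y.toEll2 ∈ saucerLower n
  · exact (h.triangle_of_lower hx hy' hp).swap_right.swap_left
  exact h.glue hx hx' hy hy' (Or.inr hp) fun s hs =>
    ⟨(h.triangle_of_neck hs hx hp).swap_right.swap_left.swap_right,
      triangleLE_of_mem_disk hp (coordDisk_subset_saucerDisk n hs) hy⟩

/-- At every stage distances and geodesics are those of the whole saucer, so no intermediate length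
metrics have to be compared. -/
theorem lowerCAT0 (n : ℕ) : LowerCAT0 n := by
  induction n with
  | zero =>
    have h0 : ∀ v, v ∉ saucerLower 0 := fun v hv => by
      obtain ⟨i, hi, -⟩ := mem_saucerLower.1 hv
      exact absurd hi (Nat.not_lt_zero i)
    exact ⟨fun x _ hx => absurd hx (h0 _), fun x _ _ hx => absurd hx (h0 _)⟩
  | succ n h =>
    refine ⟨fun x y hx hy => ?_, fun x y z hx hy hz => ?_⟩
    · rw [saucerLower_succ] at hx hy
      rcases hx with hx | hx <;> rcases hy with hy | hy
      · exact h.geodesic x y hx hy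
      · exact h.exists_isGeodesicSegment hx hy
      · obtain ⟨c, hc⟩ := h.exists_isGeodesicSegment hy hx
        exact ⟨_, hc.reverse⟩
      · exact ⟨_, isGeodesicSegment_lineMap hx hy⟩
    · rw [saucerLower_succ] at hx hy hz
      rcases hx with hx | hx <;> rcases hy with hy | hy <;> rcases hz with hz | hz
      · exact h.triangle x y z hx hy hz
      · exact h.triangle_of_lower hx hy hz
      · exact (h.triangle_of_lower hx hz hy).swap_right
      · exact (h.triangle_of_disk hy hx hz).swap_left
      · exact (h.triangle_of_lower hy hz hx).swap_right.swap_left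
      · exact h.triangle_of_disk hx hy hz
      · exact (h.triangle_of_disk hx hz hy).swap_right
      · exact triangleLE_of_mem_disk hx hy hz

end Attach

/-! ### Global geometry -/

theorem exists_common_saucerLower (x y z : HilbertFlyingSaucer) :
    ∃ n, x.toEll2 ∈ saucerLower n ∧ y.toEll2 ∈ saucerLower n ∧ z.toEll2 ∈ saucerLower n := by
  obtain ⟨i, hi⟩ := exists_mem_saucerLower x.toEll2_mem
  obtain ⟨j, hj⟩ := exists_mem_saucerLower y.toEll2_mem
  obtain ⟨k, hk⟩ := exists_mem_saucerLower z.toEll2_mem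
  exact ⟨max i (max j k), saucerLower_mono (by simp) hi, saucerLower_mono (by simp) hj,
    saucerLower_mono (by simp) hk⟩

theorem isCAT0 : IsCAT0 HilbertFlyingSaucer := by
  refine isCAT0_of_hingeLE (fun x y => ?_) fun x y z => ?_
  · obtain ⟨n, hx, hy, -⟩ := exists_common_saucerLower x y y
    exact (lowerCAT0 n).geodesic x y hx hy
  · obtain ⟨n, hx, hy, hz⟩ := exists_common_saucerLower x y z
    exact ((lowerCAT0 n).triangle x y z hx hy hz).left

theorem isComplete_disk (i : ℕ) : IsComplete (toEll2 ⁻¹' saucerDisk i) := by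
  have h : toEll2 ⁻¹' saucerDisk i = ofEll2 '' saucerDisk i := by
    ext x
    constructor
    · exact fun hx => ⟨_, hx, ofEll2_toEll2 x⟩
    · rintro ⟨v, hv, rfl⟩
      exact ofEll2_mem (saucerDisk_subset_saucerSet i) hv
  rw [h, image_eq_range]
  have hiso : Isometry fun v : saucerDisk i => ofEll2 v :=
    Isometry.of_dist_eq fun v w => dist_ofEll2 v.2 w.2
  have : CompleteSpace (saucerDisk i) := (isClosed_coordDisk _ _).completeSpace_coe
  exact hiso.isUniformInducing.isComplete_range

theorem isComplete_saucerLower (n : ℕ) : IsComplete (toEll2 ⁻¹' saucerLower n) := by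
  induction n with
  | zero =>
    have : toEll2 ⁻¹' saucerLower 0 = ∅ := by ext x; simp [saucerLower]
    rw [this]
    exact isCompact_empty.isComplete
  | succ n h =>
    rw [saucerLower_succ, preimage_union]
    exact h.union (isComplete_disk n)

/-- A Cauchy sequence is bounded and thus stays in finitely many disks, each of them complete. -/
theorem completeSpace : CompleteSpace HilbertFlyingSaucer := by
  refine Metric.complete_of_cauchySeq_tendsto fun u hu => ?_
  obtain ⟨R, -, hR⟩ := cauchySeq_bdd hu
  obtain ⟨n, hn⟩ := exists_nat_ge (R + dist (u 0) origin)
  have hmem : ∀ k, (u k).toEll2 ∈ saucerLower (n + 1) := by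
    intro k
    refine mem_saucerLower_of_norm_le (toEll2_mem _) ?_
    rw [← dist_origin]
    linarith [dist_triangle (u k) (u 0) origin, hR k 0]
  obtain ⟨a, -, ha⟩ := cauchySeq_tendsto_of_isComplete (isComplete_saucerLower (n + 1)) hmem hu
  exact ⟨a, ha⟩

/-! ### Almost orthogonal points -/

section Orthogonal

/-- A fixed vector is almost orthogonal to all vectors with many vanishing coordinates. -/
theorem exists_abs_inner_le (a : Ell2) {ε : ℝ} (hε : 0 < ε) :
    ∃ N : ℕ, ∀ y : Ell2, (∀ k < N, y k = 0) → |inner ℝ a y| ≤ ε * ‖y‖ := by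
  have h := (lp.hasSum_single (p := 2) ENNReal.ofNat_ne_top a).tendsto_sum_nat
  obtain ⟨N, hN⟩ := ((Metric.tendsto_nhds.1 h) ε hε).exists
  refine ⟨N, fun y hy => ?_⟩
  set S : Ell2 := ∑ k ∈ Finset.range N, lp.single 2 k (a k) with hS
  have h0 : inner ℝ S y = 0 := by
    rw [hS, sum_inner]
    refine Finset.sum_eq_zero fun k hk => ?_
    rw [lp.inner_single_left, hy k (Finset.mem_range.1 hk), inner_zero_right]
  have h1 : inner ℝ a y = inner ℝ (a - S) y := by rw [inner_sub_left, h0, sub_zero]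
  rw [h1]
  refine (abs_real_inner_le_norm _ _).trans ?_
  rw [dist_comm, dist_eq_norm] at hN
  gcongr

/-- The point `s • e_j`. -/
noncomputable def axisPoint (j : ℕ) (s : ℝ) : Ell2 := lp.single 2 j s

theorem norm_axisPoint (j : ℕ) {s : ℝ} (hs : 0 ≤ s) : ‖axisPoint j s‖ = s := by
  rw [axisPoint, lp.norm_single (by norm_num), Real.norm_of_nonneg hs]

theorem axisPoint_apply_of_lt {j k : ℕ} (h : k < j) (s : ℝ) : axisPoint j s k = 0 :=
  lp.single_apply_ne _ _ _ h.ne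

theorem axisPoint_mem_coordDisk {j m : ℕ} (h : m ≤ j) {r s : ℝ} (hs : 0 ≤ s) (hr : s ≤ r) :
    axisPoint j s ∈ coordDisk r m :=
  ⟨by rwa [norm_axisPoint j hs], fun _ hk => axisPoint_apply_of_lt (hk.trans_le h) s⟩

theorem axisPoint_mem_saucerDisk (j : ℕ) : axisPoint j (j + 1) ∈ saucerDisk j :=
  axisPoint_mem_coordDisk le_rfl (by positivity) le_rfl

end Orthogonal

/-! ### The ideal boundary -/

section Ideal

theorem isEmpty_geodesicRay : IsEmpty (GeodesicRay HilbertFlyingSaucer) := by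
  refine ⟨fun γ => ?_⟩
  set K := ‖(γ.toFun 0).toEll2‖ with hK
  have hK0 : 0 ≤ K := norm_nonneg _
  have hlow : ∀ t : ℝ≥0, (t : ℝ) - K ≤ ‖(γ.toFun t).toEll2‖ := fun t => by
    rw [hK, ← dist_origin, ← dist_origin]
    exact γ.le_dist origin t
  have hup : ∀ t : ℝ≥0, ‖(γ.toFun t).toEll2‖ ≤ t + K := fun t => by
    have := dist_triangle (γ.toFun t) (γ.toFun 0) origin
    rwa [γ.dist_eq, dist_origin, dist_origin, NNReal.coe_zero, sub_zero, NNReal.abs_eq] at this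
  -- The norm of `γ t` is within `K` of `t`. The contradiction needs `(s - K)² + (t - K)² - (t + K)
  -- > (t - s)²`, where `2ts` has to beat `2tK + t` and lower terms; this `s` and any `t ≥ 4K + 2`
  -- suffice.
  set s : ℝ≥0 := ⟨4 * K + 1, by positivity⟩ with hs
  have hs' : (s : ℝ) = 4 * K + 1 := rfl
  obtain ⟨N, hN⟩ := exists_abs_inner_le (γ.toFun s).toEll2 (ε := 1 / 2) (by norm_num)
  set t : ℝ≥0 := ⟨N + 4 * K + 2, by positivity⟩ with ht
  have ht' : (t : ℝ) = N + 4 * K + 2 := rfl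
  have hN0 : (0 : ℝ) ≤ N := Nat.cast_nonneg N
  have h1 := hlow s
  have h2 := hlow t
  obtain ⟨i, hi, hmem⟩ := exists_mem_saucerDisk_of_lt_norm (γ.toFun t).toEll2_mem (n := N)
    (by linarith)
  have h3 := (le_abs_self _).trans (hN _ fun k hk => hmem.2 k (hk.trans_le hi))
  have h4 := dist_toEll2_le (γ.toFun t) (γ.toFun s)
  rw [γ.dist_eq, abs_of_nonneg (by linarith), dist_eq_norm] at h4
  have h5 := pow_le_pow_left₀ (norm_nonneg _) h4 2
  rw [norm_sub_sq_real, real_inner_comm] at h5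
  have h6 := pow_le_pow_left₀ (by linarith) h1 2
  have h7 := pow_le_pow_left₀ (by linarith) h2 2
  have h8 := hup t
  rw [hs'] at h5 h6
  rw [ht'] at h5 h7 h8
  nlinarith [mul_nonneg hK0 hN0]

theorem isEmpty_idealBoundary : IsEmpty (IdealBoundary HilbertFlyingSaucer) := by
  have := isEmpty_geodesicRay
  exact ⟨fun q => Quotient.inductionOn q fun γ => this.elim γ⟩

end Ideal

/-! ### The Gromov boundary -/

section Gromov

theorem gromovProduct_comm {X : Type*} [MetricSpace X] (x y o : X) :
    gromovProduct x y o = gromovProduct y x o := by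
  unfold gromovProduct
  rw [dist_comm x y]
  ring

theorem gromovProduct_nonneg {X : Type*} [MetricSpace X] (x y o : X) :
    0 ≤ gromovProduct x y o := by
  have := dist_triangle_right x y o
  unfold gromovProduct
  linarith

/-- This reduces estimates at an arbitrary basepoint to estimates at `origin`. -/
theorem gromovProduct_sub_le {X : Type*} [MetricSpace X] (x y o o' : X) :
    gromovProduct x y o' - dist o o' ≤ gromovProduct x y o := by
  have h1 := dist_triangle x o o'
  have h2 := dist_triangle y o o'
  unfold gromovProduct
  linarith

variable {a b : HilbertFlyingSaucer}

/-- The directions of `a` and `b` at the origin diverge at a definite rate. -/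
def WideAngle (a b : HilbertFlyingSaucer) : Prop :=
  min ‖a.toEll2‖ ‖b.toEll2‖ / 5 ≤ gromovProduct a b origin

theorem WideAngle.symm (h : WideAngle a b) : WideAngle b a := by
  unfold WideAngle at *
  rwa [min_comm, gromovProduct_comm]

/-- The point `c`, which is `b` rescaled to the norm of `a`, lies in both disks because `m ≤ i`. The
connection follows the chord from `a` to `c` in disk `m` and then the radius from `c` to `b` in disk
`i`. -/
theorem wideAngle_of_inner {m i : ℕ} (ha : a.toEll2 ∈ saucerDisk m) (hb : b.toEll2 ∈ saucerDisk i)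
    (hmi : m ≤ i) (hab : ‖a.toEll2‖ ≤ ‖b.toEll2‖)
    (h : -(1 / 4 * ‖a.toEll2‖) * ‖b.toEll2‖ ≤ inner ℝ a.toEll2 b.toEll2) : WideAngle a b := by
  rw [WideAngle, min_eq_left hab]
  rcases (norm_nonneg a.toEll2).eq_or_lt with h0 | hpos
  · rw [← h0, zero_div]
    exact gromovProduct_nonneg _ _ _
  have hbpos : 0 < ‖b.toEll2‖ := hpos.trans_le hab
  set r := ‖a.toEll2‖ / ‖b.toEll2‖ with hr
  have hr0 : 0 ≤ r := by positivity
  have hr1 : r ≤ 1 := div_le_one_of_le₀ hab hbpos.le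
  have hrb : r * ‖b.toEll2‖ = ‖a.toEll2‖ := div_mul_cancel₀ _ hbpos.ne'
  have hv : ‖r • b.toEll2‖ = ‖a.toEll2‖ := by rw [norm_smul, Real.norm_of_nonneg hr0, hrb]
  have hvk : ∀ k < i, (r • b.toEll2) k = 0 := fun k hk => by
    rw [lp.coeFn_smul, Pi.smul_apply, hb.2 k hk, smul_zero]
  have hvm : r • b.toEll2 ∈ saucerDisk m :=
    ⟨hv.le.trans ha.1, fun k hk => hvk k (hk.trans_le hmi)⟩
  have hvi : r • b.toEll2 ∈ saucerDisk i := ⟨(hv.le.trans hab).trans hb.1, hvk⟩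
  set c := ofEll2 (r • b.toEll2) with hc
  have hcv : c.toEll2 = r • b.toEll2 := toEll2_ofEll2 (saucerDisk_subset_saucerSet _ hvm)
  have d1 : dist c b = ‖b.toEll2‖ - ‖a.toEll2‖ := by
    rw [dist_eq_of_mem_disk (by rwa [hcv]) hb, hcv, dist_comm, dist_eq_norm,
      show b.toEll2 - r • b.toEll2 = (1 - r) • b.toEll2 by module, norm_smul,
      Real.norm_of_nonneg (by linarith)]
    linarith
  -- The cosine is at least `-1/4`, so the squared chord is at most `5/2 < (8/5)²` times `‖a‖²`;
  -- then `(2 - 8/5) / 2 = 1/5`.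
  have d2 : dist a c ≤ 8 / 5 * ‖a.toEll2‖ := by
    refine le_of_sq_le_sq ?_ (by positivity)
    rw [dist_eq_of_mem_disk ha (by rwa [hcv]), hcv, dist_eq_norm, norm_sub_sq_real, hv,
      real_inner_smul_right]
    have h1 := mul_le_mul_of_nonneg_left h hr0
    have h2 : r * (-(1 / 4 * ‖a.toEll2‖) * ‖b.toEll2‖) = -(1 / 4) * ‖a.toEll2‖ ^ 2 := by
      rw [show r * (-(1 / 4 * ‖a.toEll2‖) * ‖b.toEll2‖) =
        -(1 / 4 * ‖a.toEll2‖) * (r * ‖b.toEll2‖) by ring, hrb]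
      ring
    nlinarith [sq_nonneg ‖a.toEll2‖]
  have := dist_triangle a c b
  unfold gromovProduct
  rw [dist_origin, dist_origin]
  linarith

theorem eventually_wideAngle (a : HilbertFlyingSaucer) {y : ℕ → HilbertFlyingSaucer}
    (hy : Tendsto (fun n => ‖(y n).toEll2‖) atTop atTop) : ∀ᶠ n in atTop, WideAngle a (y n) := by
  rcases (norm_nonneg a.toEll2).eq_or_lt with h0 | hpos
  · refine Eventually.of_forall fun n => ?_
    rw [WideAngle, ← h0, min_eq_left (norm_nonneg _), zero_div]
    exact gromovProduct_nonneg _ _ _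
  obtain ⟨m, hm⟩ := mem_iUnion.1 a.toEll2_mem
  obtain ⟨N, hN⟩ := exists_abs_inner_le a.toEll2 (ε := 1 / 4 * ‖a.toEll2‖) (by positivity)
  filter_upwards [hy.eventually_gt_atTop ((max N m : ℕ) : ℝ), hy.eventually_ge_atTop ‖a.toEll2‖]
    with n h1 h2
  obtain ⟨i, hi, hmem⟩ := exists_mem_saucerDisk_of_lt_norm (y n).toEll2_mem h1
  refine wideAngle_of_inner hm hmem ((le_max_right _ _).trans hi) h2 ?_
  have := hN _ fun k hk => hmem.2 k (hk.trans_le ((le_max_left _ _).trans hi))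
  linarith [(abs_le.1 this).1]

theorem tendsto_min_prod {u v : ℕ → ℝ} (hu : Tendsto u atTop atTop) (hv : Tendsto v atTop atTop) :
    Tendsto (fun p : ℕ × ℕ => min (u p.1) (v p.2)) atTop atTop := by
  rw [← prod_atTop_atTop_eq]
  refine tendsto_atTop.2 fun c => ?_
  filter_upwards [(hu.comp tendsto_fst).eventually_ge_atTop c,
    (hv.comp tendsto_snd).eventually_ge_atTop c] with p h₁ h₂
  exact le_min h₁ h₂

/-- Sequences that tend to infinity and enclose wide angles have Gromov products that tend
to infinity. -/
theorem tendsto_gromovProduct_of_wideAngle (o : HilbertFlyingSaucer) {x y : ℕ → HilbertFlyingSaucer}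
    (hx : Tendsto (fun n => ‖(x n).toEll2‖) atTop atTop)
    (hy : Tendsto (fun n => ‖(y n).toEll2‖) atTop atTop) (h : ∀ m n, WideAngle (x m) (y n)) :
    Tendsto (fun p : ℕ × ℕ => gromovProduct (x p.1) (y p.2) o) atTop atTop := by
  refine tendsto_atTop_mono
    (fun p => (sub_le_sub_right (h p.1 p.2) _).trans (gromovProduct_sub_le _ _ o origin)) ?_
  exact tendsto_atTop_add_const_right _ _ ((tendsto_min_prod hx hy).atTop_div_const (by norm_num))

/-- On the diagonal the Gromov product is the distance to the basepoint. -/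
theorem tendsto_norm_of_isGromovSeq {o : HilbertFlyingSaucer} {x : ℕ → HilbertFlyingSaucer}
    (hx : IsGromovSeq o x) : Tendsto (fun n => ‖(x n).toEll2‖) atTop atTop := by
  have h : Tendsto (fun n => gromovProduct (x n) (x n) o) atTop atTop :=
    Tendsto.comp (f := fun n : ℕ => (n, n))
      (g := fun p : ℕ × ℕ => gromovProduct (x p.1) (x p.2) o) hx tendsto_atTop_diagonal
  refine tendsto_atTop_mono (fun n => ?_) (tendsto_atTop_add_const_right _ (-dist o origin) h)
  have := dist_triangle_right (x n) o origin
  rw [← dist_origin, gromovProduct, dist_self]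
  linarith

/-- The index pairs are chosen inductively. Each new point only has to be far out relative to the
finitely many points chosen before it, since the estimate is not uniform in the fixed point. -/
theorem exists_interlaced {x y : ℕ → HilbertFlyingSaucer}
    (hx : Tendsto (fun n => ‖(x n).toEll2‖) atTop atTop)
    (hy : Tendsto (fun n => ‖(y n).toEll2‖) atTop atTop) :
    ∃ φ ψ : ℕ → ℕ, StrictMono φ ∧ StrictMono ψ ∧ ∀ m n, WideAngle (x (φ m)) (y (ψ n)) := by
  obtain ⟨f, hP, hr⟩ := exists_seq_of_forall_finset_exists
    (fun p : ℕ × ℕ => WideAngle (x p.1) (y p.2))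
    (fun p q => p.1 < q.1 ∧ p.2 < q.2 ∧ WideAngle (x p.1) (y q.2) ∧ WideAngle (x q.1) (y p.2)) (by
      intro s _
      have h1 : ∀ᶠ j in atTop, ∀ p ∈ s, p.1 < j ∧ WideAngle (x j) (y p.2) :=
        (Filter.eventually_all_finset s).2 fun p _ => (eventually_gt_atTop p.1).and
          ((eventually_wideAngle (y p.2) hx).mono fun _ h => h.symm)
      obtain ⟨j, hj⟩ := h1.exists
      have h2 : ∀ᶠ k in atTop, ∀ p ∈ s, p.2 < k ∧ WideAngle (x p.1) (y k) :=
        (Filter.eventually_all_finset s).2 fun p _ => (eventually_gt_atTop p.2).and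
          (eventually_wideAngle (x p.1) hy)
      obtain ⟨k, hk, hjk⟩ := (h2.and (eventually_wideAngle (x j) hy)).exists
      exact ⟨(j, k), hjk, fun p hp => ⟨(hj p hp).1, (hk p hp).1, (hk p hp).2, (hj p hp).2⟩⟩)
  refine ⟨fun n => (f n).1, fun n => (f n).2, fun m n h => (hr m n h).1,
    fun m n h => (hr m n h).2.1, fun m n => ?_⟩
  rcases lt_trichotomy m n with h | rfl | h
  · exact (hr m n h).2.2.1
  · exact hP m
  · exact (hr n m h).2.2.2

theorem tendsto_prodMap {φ ψ : ℕ → ℕ} (hφ : Tendsto φ atTop atTop) (hψ : Tendsto ψ atTop atTop) :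
    Tendsto (Prod.map φ ψ) atTop atTop := by
  rw [← prod_atTop_atTop_eq]
  exact hφ.prodMap hψ

/-- A subsequence of a Gromov sequence. -/
def subseq {X : Type*} [MetricSpace X] {o : X} (x : GromovSeq X o) {φ : ℕ → ℕ}
    (hφ : StrictMono φ) : GromovSeq X o :=
  ⟨x.1 ∘ φ, x.2.comp (tendsto_prodMap hφ.tendsto_atTop hφ.tendsto_atTop)⟩

theorem gromovRel_subseq {X : Type*} [MetricSpace X] {o : X} (x : GromovSeq X o) {φ : ℕ → ℕ}
    (hφ : StrictMono φ) : gromovRel o x (subseq x hφ) :=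
  x.2.comp (tendsto_prodMap tendsto_id hφ.tendsto_atTop)

/-- Only subsequences are compared directly, so the chain has three links: `x`, a subsequence of
`x`, a subsequence of `y`, and `y`. -/
theorem transGen_gromovRel {o : HilbertFlyingSaucer} (x y : GromovSeq HilbertFlyingSaucer o) :
    Relation.TransGen (gromovRel o) x y := by
  have hx := tendsto_norm_of_isGromovSeq x.2
  have hy := tendsto_norm_of_isGromovSeq y.2
  obtain ⟨φ, ψ, hφ, hψ, h⟩ := exists_interlaced hx hy
  have h1 : gromovRel o (subseq x hφ) (subseq y hψ) :=
    tendsto_gromovProduct_of_wideAngle o (hx.comp hφ.tendsto_atTop) (hy.comp hψ.tendsto_atTop) h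
  exact ((Relation.TransGen.single (gromovRel_subseq x hφ)).tail h1).tail
    (gromovRel_symm o _ _ (gromovRel_subseq y hψ))

theorem toEll2_axis (j : ℕ) : (ofEll2 (axisPoint j (j + 1))).toEll2 = axisPoint j (j + 1) :=
  toEll2_ofEll2 (saucerDisk_subset_saucerSet j (axisPoint_mem_saucerDisk j))

theorem norm_toEll2_axis (j : ℕ) : ‖(ofEll2 (axisPoint j (j + 1))).toEll2‖ = j + 1 := by
  rw [toEll2_axis, norm_axisPoint j (by positivity)]

/-- The points `(n + 1) • e_n` on the rims of the disks are pairwise orthogonal, so all pairs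
enclose wide angles. -/
theorem exists_isGromovSeq (o : HilbertFlyingSaucer) : ∃ x, IsGromovSeq o x := by
  obtain ⟨x, hx⟩ : ∃ x : ℕ → HilbertFlyingSaucer, ∀ n : ℕ, (x n).toEll2 = axisPoint n (n + 1) :=
    ⟨fun n => ofEll2 (axisPoint n (n + 1)), toEll2_axis⟩
  have hnorm : ∀ n : ℕ, ‖(x n).toEll2‖ = n + 1 := fun n => by
    rw [hx, norm_axisPoint n (by positivity)]
  have hdisk : ∀ n, (x n).toEll2 ∈ saucerDisk n := fun n => by
    rw [hx]
    exact axisPoint_mem_saucerDisk n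
  have hlim : Tendsto (fun n => ‖(x n).toEll2‖) atTop atTop := by
    simp only [hnorm]
    exact tendsto_atTop_add_const_right _ _ tendsto_natCast_atTop_atTop
  have hle : ∀ m n : ℕ, m ≤ n → WideAngle (x m) (x n) := by
    intro m n hmn
    refine wideAngle_of_inner (hdisk m) (hdisk n) hmn ?_ ?_
    · rw [hnorm, hnorm]
      exact_mod_cast Nat.succ_le_succ hmn
    · have h0 : 0 ≤ inner ℝ (x m).toEll2 (x n).toEll2 := by
        rcases hmn.eq_or_lt with rfl | hlt
        · exact real_inner_self_nonneg
        · rw [hx, hx, axisPoint, lp.inner_single_left, axisPoint_apply_of_lt hlt, inner_zero_right]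
      have := mul_nonneg (norm_nonneg (x m).toEll2) (norm_nonneg (x n).toEll2)
      linarith
  refine ⟨x, tendsto_gromovProduct_of_wideAngle o hlim hlim fun m n => ?_⟩
  rcases le_total m n with h | h
  · exact hle m n h
  · exact (hle n m h).symm

theorem nonempty_unique_gromovBoundary (o : HilbertFlyingSaucer) :
    Nonempty (Unique (GromovBoundary HilbertFlyingSaucer o)) := by
  obtain ⟨x, hx⟩ := exists_isGromovSeq o
  exact ⟨{ default := Quotient.mk (gromovSetoid o) ⟨x, hx⟩
           uniq := fun q => Quotient.inductionOn q fun y =>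
            Quotient.sound (s := gromovSetoid o) (transGen_gromovRel y _) }⟩

end Gromov

/-! ### The end boundary -/

section Ends

/-- A segment between almost orthogonal points stays away from the origin. -/
theorem half_le_norm_of_inner {E : Type*} [NormedAddCommGroup E] [InnerProductSpace ℝ E] {x w : E}
    (hwx : ‖w‖ ≤ ‖x‖) (h : -(1 / 4 * ‖w‖) * ‖x‖ ≤ inner ℝ x w) {a b : ℝ} (ha : 0 ≤ a)
    (hb : 0 ≤ b) (hab : a + b = 1) : ‖w‖ / 2 ≤ ‖a • x + b • w‖ := by
  refine le_of_sq_le_sq ?_ (norm_nonneg _)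
  rw [norm_add_sq_real, norm_smul, norm_smul, Real.norm_of_nonneg ha, Real.norm_of_nonneg hb,
    real_inner_smul_left, real_inner_smul_right]
  have h1 := mul_le_mul_of_nonneg_left h (mul_nonneg ha hb)
  have h2 : ‖w‖ ≤ a * ‖x‖ + b * ‖w‖ := by
    have := mul_le_mul_of_nonneg_left hwx ha
    have h3 : a * ‖w‖ + b * ‖w‖ = ‖w‖ := by rw [← add_mul, hab, one_mul]
    linarith
  have h4 := pow_le_pow_left₀ (norm_nonneg _) h2 2
  -- With `A = a‖x‖` and `B = b‖w‖`, the squared norm is at least `A² + B² - AB/2 ≥ (A + B)²/4`, and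
  -- `A + B ≥ ‖w‖`.
  nlinarith [sq_nonneg (a * ‖x‖ - b * ‖w‖)]

theorem exists_isPreconnected_to_axis {x : HilbertFlyingSaucer} {m j : ℕ} {s R : ℝ}
    (hx : x.toEll2 ∈ saucerDisk m) (hmj : m ≤ j) (hs : 0 ≤ s) (hsx : s ≤ ‖x.toEll2‖)
    (hR : 2 * R < s) (h : |inner ℝ x.toEll2 (axisPoint j s)| ≤ 1 / 4 * ‖x.toEll2‖ * s) :
    ∃ S : Set HilbertFlyingSaucer, IsPreconnected S ∧ x ∈ S ∧ ofEll2 (axisPoint j s) ∈ S ∧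
      ∀ z ∈ S, R < ‖z.toEll2‖ := by
  have hw : axisPoint j s ∈ saucerDisk m := axisPoint_mem_coordDisk hmj hs (hsx.trans hx.1)
  have hseg : segment ℝ x.toEll2 (axisPoint j s) ⊆ saucerDisk m :=
    (convex_coordDisk _ _).segment_subset hx hw
  refine ⟨ofEll2 '' segment ℝ x.toEll2 (axisPoint j s),
    (convex_segment _ _).isPreconnected.image _ ((continuousOn_ofEll2 m).mono hseg),
    ⟨_, left_mem_segment ℝ _ _, ofEll2_toEll2 x⟩, ⟨_, right_mem_segment ℝ _ _, rfl⟩, ?_⟩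
  rintro _ ⟨v, hv, rfl⟩
  rw [toEll2_ofEll2 (saucerDisk_subset_saucerSet m (hseg hv))]
  obtain ⟨a, b, ha, hb, hab, rfl⟩ := hv
  have h1 := half_le_norm_of_inner (x := x.toEll2) (w := axisPoint j s)
    (by rwa [norm_axisPoint j hs])
    (by rw [norm_axisPoint j hs]; linarith [(abs_le.1 h).1]) ha hb hab
  rw [norm_axisPoint j hs] at h1
  linarith

/-- Any two points far from the origin lie in a connected set far from the origin. -/
theorem exists_isPreconnected {x y : HilbertFlyingSaucer} {R : ℝ} (hR : 0 ≤ R)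
    (hx : 2 * R < ‖x.toEll2‖) (hy : 2 * R < ‖y.toEll2‖) :
    ∃ S : Set HilbertFlyingSaucer, IsPreconnected S ∧ x ∈ S ∧ y ∈ S ∧ ∀ z ∈ S, R < ‖z.toEll2‖ := by
  obtain ⟨m, hm⟩ := mem_iUnion.1 x.toEll2_mem
  obtain ⟨n, hn⟩ := mem_iUnion.1 y.toEll2_mem
  obtain ⟨M, hM⟩ := exists_abs_inner_le x.toEll2 (ε := 1 / 4 * ‖x.toEll2‖) (by linarith)
  obtain ⟨N, hN⟩ := exists_abs_inner_le y.toEll2 (ε := 1 / 4 * ‖y.toEll2‖) (by linarith)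
  -- The smaller norm puts `s • e_j` into a disk of `x` and a disk of `y` as soon as `j` exceeds
  -- their indices; a large `j` also makes it almost orthogonal to both.
  set s := min ‖x.toEll2‖ ‖y.toEll2‖ with hs
  have hs0 : 0 ≤ s := by positivity
  have hsR : 2 * R < s := lt_min hx hy
  set j := max (max m n) (max M N) with hj
  have hMj := hM (axisPoint j s) fun k hk => axisPoint_apply_of_lt (by omega) s
  have hNj := hN (axisPoint j s) fun k hk => axisPoint_apply_of_lt (by omega) s
  rw [norm_axisPoint j hs0] at hMj hNj
  obtain ⟨S, hS, hxS, hwS, hSR⟩ := exists_isPreconnected_to_axis hm (by omega) hs0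
    (min_le_left _ _) hsR hMj
  obtain ⟨T, hT, hyT, hwT, hTR⟩ := exists_isPreconnected_to_axis hn (by omega) hs0
    (min_le_right _ _) hsR hNj
  refine ⟨S ∪ T, hS.union _ hwS hwT hT, Or.inl hxS, Or.inr hyT, ?_⟩
  rintro z (hz | hz)
  · exact hSR z hz
  · exact hTR z hz

/-- Points far away lie in the same component of the complement of a ball. -/
theorem connectedComponentIn_eq_of_lt_norm (o : HilbertFlyingSaucer) (n : ℕ)
    {x y : HilbertFlyingSaucer} (hx : 2 * (n + ‖o.toEll2‖) < ‖x.toEll2‖)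
    (hy : 2 * (n + ‖o.toEll2‖) < ‖y.toEll2‖) :
    connectedComponentIn (closure (Metric.ball o (n : ℝ)))ᶜ x =
      connectedComponentIn (closure (Metric.ball o (n : ℝ)))ᶜ y := by
  obtain ⟨S, hS, hxS, hyS, hSR⟩ := exists_isPreconnected (by positivity) hx hy
  refine connectedComponentIn_eq (hS.subset_connectedComponentIn hxS (fun z hz => ?_) hyS)
  refine mem_compl_closure_ball ?_
  have h1 := hSR z hz
  have h2 := dist_triangle z o origin
  rw [dist_origin, dist_origin] at h2
  linarith

theorem endBoundary_antitone {X : Type*} [MetricSpace X] {o : X} (U : EndBoundary X o) :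
    Antitone U.U := antitone_nat_of_succ_le U.nested

/-- Every set of an end is the component of a point far away. -/
theorem exists_endBoundary_eq {o : HilbertFlyingSaucer} (U : EndBoundary HilbertFlyingSaucer o)
    (n : ℕ) (R : ℝ) : ∃ x : HilbertFlyingSaucer, R < ‖x.toEll2‖ ∧
      U.U n = connectedComponentIn (closure (Metric.ball o (n : ℝ)))ᶜ x := by
  obtain ⟨k, hk⟩ := exists_nat_gt (R + ‖o.toEll2‖)
  -- A point of a later set of the end is far away and, by nestedness, still belongs to `U n`.
  obtain ⟨x, hx, hUx⟩ := U.isComponent (max n k)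
  obtain ⟨y, -, hUy⟩ := U.isComponent n
  have hmem : x ∈ U.U n := by
    refine endBoundary_antitone U (le_max_left n k) ?_
    rw [hUx]
    exact mem_connectedComponentIn hx
  refine ⟨x, ?_, ?_⟩
  · have h1 : ((max n k : ℕ) : ℝ) ≤ dist x o := by
      by_contra! hlt
      exact hx (subset_closure hlt)
    have h2 : (k : ℝ) ≤ ((max n k : ℕ) : ℝ) := by exact_mod_cast le_max_right n k
    have h3 := dist_triangle_right x o origin
    rw [dist_origin, dist_origin] at h3
    linarith
  · rw [hUy] at hmem ⊢
    exact connectedComponentIn_eq hmem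

/-- The `n`-th set of the end is the component of any point of norm greater than `2 * (n + ‖o‖)`;
nestedness and uniqueness both follow from independence of this choice. -/
theorem nonempty_unique_endBoundary (o : HilbertFlyingSaucer) :
    Nonempty (Unique (EndBoundary HilbertFlyingSaucer o)) := by
  have hfar : ∀ n : ℕ, ∃ x : HilbertFlyingSaucer, 2 * (n + ‖o.toEll2‖) < ‖x.toEll2‖ := fun n => by
    obtain ⟨k, hk⟩ := exists_nat_gt (2 * (n + ‖o.toEll2‖))
    exact ⟨ofEll2 (axisPoint k (k + 1)), by rw [norm_toEll2_axis]; linarith⟩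
  choose p hp using hfar
  refine ⟨{ default := ⟨fun n => connectedComponentIn (closure (Metric.ball o (n : ℝ)))ᶜ (p n),
    fun n => ⟨p n, mem_compl_closure_ball ?_, rfl⟩, fun n => ?_⟩, uniq := fun U => ?_ }⟩
  · have h := dist_triangle (p n) o origin
    rw [dist_origin, dist_origin] at h
    linarith [hp n, norm_nonneg o.toEll2, Nat.cast_nonneg (α := ℝ) n]
  · have h := hp (n + 1)
    push_cast at h
    rw [connectedComponentIn_eq_of_lt_norm o n (hp n) (y := p (n + 1)) (by linarith)]
    refine connectedComponentIn_mono _ (compl_subset_compl.2 (closure_mono ?_))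
    exact Metric.ball_subset_ball (by push_cast; linarith)
  · ext1
    funext n
    obtain ⟨x, hx, hUx⟩ := exists_endBoundary_eq U n (2 * (n + ‖o.toEll2‖))
    rw [hUx]
    exact connectedComponentIn_eq_of_lt_norm o n hx (hp n)

end Ends

end HilbertFlyingSaucer

theorem theorem3p4 :
    CompleteSpace HilbertFlyingSaucer ∧
    ∃ hX : IsCAT0 HilbertFlyingSaucer,
      IsEmpty (IdealBoundary HilbertFlyingSaucer) ∧
      ∀ o : HilbertFlyingSaucer,
        Nonempty (Unique (GromovBoundary HilbertFlyingSaucer o)) ∧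
        Nonempty (Unique (EndBoundary HilbertFlyingSaucer o)) ∧
        ¬ Function.Surjective
          (nuMap o : IdealBoundary HilbertFlyingSaucer → GromovBoundary HilbertFlyingSaucer o) ∧
        ¬ Function.Surjective
          (epsilonMap hX.geodesic o :
            IdealBoundary HilbertFlyingSaucer → EndBoundary HilbertFlyingSaucer o) := by
  have hI := HilbertFlyingSaucer.isEmpty_idealBoundary
  refine ⟨HilbertFlyingSaucer.completeSpace, HilbertFlyingSaucer.isCAT0, hI, fun o => ?_⟩
  obtain ⟨hG⟩ := HilbertFlyingSaucer.nonempty_unique_gromovBoundary o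
  obtain ⟨hE⟩ := HilbertFlyingSaucer.nonempty_unique_endBoundary o
  exact ⟨⟨hG⟩, ⟨hE⟩, fun h => hI.elim (h default).choose, fun h => hI.elim (h default).choose⟩
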